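/- Let $n,L\ge 1$ and $d=2^n$. Let $O$ be a Hermitian $d\times d$ matrix, let $H_1,\dots,H_L$ be Hermitian $d\times d$ matrices, and let $\lambda^l_1,\dots,\lambda^l_d$ be the eigenvalues of $H_l$ with multiplicity, belonging to an orthonormal eigenbasis $v^l_1,\dots,v^l_d$. Let $W^1,\dots,W^{L+1}$ be independent random elements of the unitary group $U(d)$, defined on a common probability space with points $\theta$, each of which is a 2-design: $\mathbb E[W^l\otimes W^l\otimes \overline{W^l}\otimes\overline{W^l}]$ equals $\int U\otimes U\otimes\overline U\otimes\overline U\,dU$, where $dU$ is the Haar probability measure on $U(d)$. Consider the $L$-layer reuploading model $$f(x,\theta)=\langle 0|U(x,\theta)^\dagger\, O\, U(x,\theta)|0\rangle,\qquad U(x,\theta)=W^{L+1}e^{-ixH_L}W^L\cdots e^{-ixH_1}W^1,\qquad x\in\mathbb R .$$ For $J=(j_1,\dots,j_L)\in\{1,\dots,d\}^L$ put $\Lambda_J=\sum_l\lambda^l_{j_l}$ and $A_J=W^{L+1}|v^L_{j_L}\rangle\langle v^L_{j_L}|W^L\cdots|v^1_{j_1}\rangle\langle v^1_{j_1}|W^1$.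 Let $\Omega=\{\Lambda_J-\Lambda_{J'}\}$ be the set of distinct frequencies and $$c_\omega(\theta)=\sum_{(J,J'):\ \Lambda_J-\Lambda_{J'}=\omega}\langle 0|A_J^\dagger\, O\,A_{J'}|0\rangle .$$ For $1\le h\le l\le L$ let $|R_h^l(\omega)|$ be the number of pairs $((j_h,\dots,j_l),(j'_h,\dots,j'_l))$ with $\sum_{k=h}^l(\lambda^k_{j_k}-\lambda^k_{j'_k})=\omega$; by convention $|R_2^1(\omega)|=\delta_{\omega,0}$. Let $\Omega^l$ be the set of distinct differences $\lambda^l_j-\lambda^l_{j'}$. Put $\|O\|_2^2=\mathrm{Tr}(O^2)$, $$C_1=\frac{d\,\mathrm{Tr}(O)^2-\|O\|_2^2}{d(d^2-1)},\qquad C_2=\frac{d\,\|O\|_2^2-\mathrm{Tr}(O)^2}{d(d^2-1)} ,$$ and write $\mathrm{Var}[c]=\mathbb E|c-\mathbb E c|^2$. For weights $a=(a_l(k))$ define functions $B^m_a$ by $B^1_a(\omega)=\frac{\delta_{\omega,0}}{d+1}+\frac{|R_1^1(\omega)|}{d(d+1)}$ and, for $2\le m\le L$, $$B_a^m(\omega)=\sum_{k\in\Omega^m}a_m(k)\,B_a^{m-1}(\omega-k)+\frac{d\,\delta_{\omega,0}}{d^2-1}-\frac{|R_m^m(\omega)|}{d(d^2-1)}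 .$$ Let $\alpha_l(k)=\frac{|R_l^l(k)|-\delta_{k,0}}{d^2-1}$ be the exact weights and $\tilde\alpha_l(k)=\frac{|R_l^l(k)|}{d^2-1}$ the approximate ones. Finally let $$F(\omega)=C_2\left[\frac{|R_1^L(\omega)|-|R_2^L(\omega)|}{d(d+1)(d^2-1)^{L-1}}+\sum_{j=3}^{L}\frac{|R_j^L(\omega)|}{d(d^2-1)^{L-j+2}}+\varepsilon_L\frac{\delta_{\omega,0}}{d(d^2-1)}\right],$$ where $\varepsilon_L=1$ for $L\ge2$ and $\varepsilon_1=0$. Then: 1. For all $\theta$ and all $x\in\mathbb R$, $f(x,\theta)=\sum_{\omega\in\Omega}c_\omega(\theta)e^{i\omega x}$. 2. For every $\omega\in\Omega$, $c_\omega$ is square integrable, $\mathbb E[c_\omega]=\frac{\mathrm{Tr}(O)}{d}\delta_{\omega,0}$, and exactly $$\mathrm{Var}[c_\omega]=\Big(C_1-\frac{\mathrm{Tr}(O)^2}{d^2}\Big)\delta_{\omega,0}+C_2\,B^L_\alpha(\omega).$$ 3. Replacing $\alpha$ by $\tilde\alpha$ in this recursion gives the closed form $F$: for every $\omega\in\Omega$,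 $$F(\omega)=\Big(C_1-\frac{\mathrm{Tr}(O)^2}{d^2}\Big)\delta_{\omega,0}+C_2\,B^L_{\tilde\alpha}(\omega).$$ 4. $\mathrm{Var}[c_\omega]\simeq F(\omega)$ in the following sense. For every $\omega\in\Omega$, $$0\le F(\omega)-\mathrm{Var}[c_\omega]\le\frac{L-1}{d}F(\omega)+\frac{C_2}{d}\left[\Big(\frac{d^2}{d^2-1}\Big)^{L-1}-1\right],$$ and over the whole spectrum $$\sum_{\omega\in\Omega}\big|\mathrm{Var}[c_\omega]-F(\omega)\big|=\frac{d}{d-1}\left[\Big(\frac{d^2}{d^2-1}\Big)^{L-1}-1\right]\sum_{\omega\in\Omega}\mathrm{Var}[c_\omega].$$ In particular $\mathrm{Var}[c_\omega]=F(\omega)$ for $L=1$, and for fixed $L$ the total relative error is $O(1/d^2)$. -/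

import Mathlib

open scoped Kronecker

/-! ### The unitary group, its Haar probability measure, and unitary 2-designs -/

instance unitaryGroupCompactSpace (d : ℕ) : CompactSpace (Matrix.unitaryGroup (Fin d) ℂ) := by
  suffices h : IsCompact (Matrix.unitaryGroup (Fin d) ℂ : Set (Matrix (Fin d) (Fin d) ℂ)) from
    isCompact_iff_compactSpace.mp h
  have hK : IsCompact (Set.pi Set.univ fun _ : Fin d =>
      Set.pi Set.univ fun _ : Fin d => Metric.closedBall (0 : ℂ) 1) :=
    isCompact_univ_pi fun _ => isCompact_univ_pi fun _ => isCompact_closedBall 0 1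
  have hC : IsClosed {U : Matrix (Fin d) (Fin d) ℂ | U * star U = 1} :=
    isClosed_eq (continuous_id.mul continuous_star) continuous_const
  refine IsCompact.of_isClosed_subset (s := Set.pi Set.univ fun _ : Fin d =>
      Set.pi Set.univ fun _ : Fin d => Metric.closedBall (0 : ℂ) 1) hK ?_ ?_
  · have hE : (Matrix.unitaryGroup (Fin d) ℂ : Set (Matrix (Fin d) (Fin d) ℂ)) =
        {U | U * star U = 1} := Set.ext fun _ => Matrix.mem_unitaryGroup_iff
    rw [hE]
    exact hC
  · intro U hU i _ j _
    simpa using entry_norm_bound_of_unitary hU i j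

/-- The unitary group `U(d)` carries its Borel σ-algebra. -/
noncomputable instance unitaryGroupMeasurableSpace (d : ℕ) :
    MeasurableSpace (Matrix.unitaryGroup (Fin d) ℂ) := borel _

instance unitaryGroupBorelSpace (d : ℕ) : BorelSpace (Matrix.unitaryGroup (Fin d) ℂ) := ⟨rfl⟩

/-- The Haar measure on `U(d)`, normalized to total mass one. -/
noncomputable def unitaryHaar (d : ℕ) : MeasureTheory.Measure (Matrix.unitaryGroup (Fin d) ℂ) :=
  MeasureTheory.Measure.haarMeasure ⊤

/-- The second moment superoperator `∫ W ⊗ W ⊗ W* ⊗ W*` of a random unitary (`W*` is the entrywise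
complex conjugate); the integral is taken entry by entry. -/
noncomputable def secondMoment {Θ : Type*} [MeasurableSpace Θ] (μ : MeasureTheory.Measure Θ)
    {d : ℕ} (W : Θ → Matrix.unitaryGroup (Fin d) ℂ) :
    Matrix (((Fin d × Fin d) × Fin d) × Fin d) (((Fin d × Fin d) × Fin d) × Fin d) ℂ :=
  Matrix.of fun a b => ∫ θ,
    ((W θ : Matrix (Fin d) (Fin d) ℂ) ⊗ₖ (W θ : Matrix (Fin d) (Fin d) ℂ) ⊗ₖ
      (W θ : Matrix (Fin d) (Fin d) ℂ).map star ⊗ₖ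
      (W θ : Matrix (Fin d) (Fin d) ℂ).map star) a b ∂μ

/-- A random unitary is an (exact) 2-design if its second moment superoperator is that of the
Haar distribution. -/
def IsTwoDesign {Θ : Type*} [MeasurableSpace Θ] (μ : MeasureTheory.Measure Θ)
    {d : ℕ} (W : Θ → Matrix.unitaryGroup (Fin d) ℂ) : Prop :=
  secondMoment μ W = secondMoment (unitaryHaar d) id

/-! ### Reuploading models -/

/-- The fixed (untrained) data of an `L`-layer reuploading model on `n` qubits: a Hermitian
observable and one Hermitian encoding Hamiltonian per layer. -/
structure ReuploadingModel (n L : ℕ) where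
  observable : Matrix (Fin (2 ^ n)) (Fin (2 ^ n)) ℂ
  observable_isHermitian : observable.IsHermitian
  hamiltonian : Fin L → Matrix (Fin (2 ^ n)) (Fin (2 ^ n)) ℂ
  hamiltonian_isHermitian : ∀ l, (hamiltonian l).IsHermitian

namespace ReuploadingModel

variable {n L : ℕ} (M : ReuploadingModel n L)

/-- The encoding unitary `exp(-i x H_l)`. -/
noncomputable def encoding (l : Fin L) (x : ℝ) : Matrix (Fin (2 ^ n)) (Fin (2 ^ n)) ℂ :=
  NormedSpace.exp ((-(Complex.I * (x : ℂ))) • M.hamiltonian l)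

/-- The circuit `W^{L+1} S^L(x) W^L ⋯ S^1(x) W^1`; the layers, numbered from `1` to `L`, have
indices `0, …, L - 1` in `Fin L`. -/
noncomputable def circuit (W : Fin (L + 1) → Matrix.unitaryGroup (Fin (2 ^ n)) ℂ) (x : ℝ) :
    Matrix (Fin (2 ^ n)) (Fin (2 ^ n)) ℂ :=
  (W (Fin.last L) : Matrix (Fin (2 ^ n)) (Fin (2 ^ n)) ℂ) *
    (List.ofFn fun l : Fin L =>
      M.encoding l x * (W l.castSucc : Matrix (Fin (2 ^ n)) (Fin (2 ^ n)) ℂ)).reverse.prod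

/-- The model `f = ⟨0| U† O U |0⟩`. -/
noncomputable def model (W : Fin (L + 1) → Matrix.unitaryGroup (Fin (2 ^ n)) ℂ) (x : ℝ) : ℂ :=
  ((M.circuit W x).conjTranspose * M.observable * M.circuit W x) 0 0

/-- The eigenvalues `λ^l_j` of the encoding Hamiltonians, repeated with multiplicity. -/
noncomputable def eigenvalue (l : Fin L) (j : Fin (2 ^ n)) : ℝ :=
  (M.hamiltonian_isHermitian l).eigenvalues j

/-- The rank one projector `|v⟩⟨v|` onto the `j`-th vector `v` of an orthonormal eigenbasis of
the `l`-th Hamiltonian. -/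
noncomputable def eigenprojector (l : Fin L) (j : Fin (2 ^ n)) :
    Matrix (Fin (2 ^ n)) (Fin (2 ^ n)) ℂ :=
  Matrix.of fun a b => (M.hamiltonian_isHermitian l).eigenvectorBasis j a *
    star ((M.hamiltonian_isHermitian l).eigenvectorBasis j b)

/-- The contribution `W^{L+1} P^L_{j_L} W^L ⋯ P^1_{j_1} W^1` of the path `J = (j_1, …, j_L)`. -/
noncomputable def pathOperator (W : Fin (L + 1) → Matrix.unitaryGroup (Fin (2 ^ n)) ℂ)
    (J : Fin L → Fin (2 ^ n)) : Matrix (Fin (2 ^ n)) (Fin (2 ^ n)) ℂ :=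
  (W (Fin.last L) : Matrix (Fin (2 ^ n)) (Fin (2 ^ n)) ℂ) *
    (List.ofFn fun l : Fin L =>
      M.eigenprojector l (J l) *
        (W l.castSucc : Matrix (Fin (2 ^ n)) (Fin (2 ^ n)) ℂ)).reverse.prod

/-- The encoding layers `h, …, l`, numbered from `1` to `L`. -/
abbrev LayerRange (L h l : ℕ) : Type := {k : Fin L // h ≤ (k : ℕ) + 1 ∧ (k : ℕ) + 1 ≤ l}

/-- The frequency `∑_{k=h}^{l} (λ^k_{j_k} - λ^k_{j'_k})` of a pair of partial paths. -/
noncomputable def pairFrequency (h l : ℕ)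
    (p : (LayerRange L h l → Fin (2 ^ n)) × (LayerRange L h l → Fin (2 ^ n))) : ℝ :=
  ∑ k : LayerRange L h l, (M.eigenvalue k.1 (p.1 k) - M.eigenvalue k.1 (p.2 k))

open Classical in
/-- The set of distinct frequencies generated by the layers `h, …, l`. -/
noncomputable def partialSpectrum (h l : ℕ) : Finset ℝ :=
  Finset.univ.image (M.pairFrequency h l)

/-- The spectrum `Ω` of the model. -/
noncomputable def spectrum : Finset ℝ := M.partialSpectrum 1 L

open Classical in
/-- The partial frequency generator `R_h^l(ω)`. For `h = l + 1` there are no layers, only the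
empty pair of paths, of frequency `0`. -/
noncomputable def partialGenerator (h l : ℕ) (ω : ℝ) :
    Finset ((LayerRange L h l → Fin (2 ^ n)) × (LayerRange L h l → Fin (2 ^ n))) :=
  Finset.univ.filter fun p => M.pairFrequency h l p = ω

/-- The partial redundancy `|R_h^l(ω)|`. -/
noncomputable def redundancy (h l : ℕ) (ω : ℝ) : ℝ := ((M.partialGenerator h l ω).card : ℝ)

open Classical in
/-- The Fourier coefficient `c_ω`: the sum over all pairs of paths `(J, J')` of frequency
`Λ_J - Λ_{J'} = ω` of the contribution of that pair to `⟨0| U† O U |0⟩`, where `J` is the path in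
`U†` and `J'` the path in `U`, so that the pair comes with the phase `e^{iωx}`. -/
noncomputable def fourierCoeff (W : Fin (L + 1) → Matrix.unitaryGroup (Fin (2 ^ n)) ℂ)
    (ω : ℝ) : ℂ :=
  ∑ p : (Fin L → Fin (2 ^ n)) × (Fin L → Fin (2 ^ n)),
    if ∑ l, (M.eigenvalue l (p.1 l) - M.eigenvalue l (p.2 l)) = ω then
      ((M.pathOperator W p.1).conjTranspose * M.observable * M.pathOperator W p.2) 0 0
    else 0

/-- The dimension `d = 2^n` as a real number. -/
noncomputable def dim (_M : ReuploadingModel n L) : ℝ := 2 ^ n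

/-- The (real) trace of the observable. -/
noncomputable def traceO : ℝ := M.observable.trace.re

/-- The squared Hilbert–Schmidt norm `‖O‖₂²` of the observable. -/
noncomputable def normSqO : ℝ := ∑ a, ∑ b, ‖M.observable a b‖ ^ 2

/-- `C₁ = (d Tr(O)² - ‖O‖₂²) / (d (d² - 1))`. -/
noncomputable def coeffOne : ℝ :=
  (M.dim * M.traceO ^ 2 - M.normSqO) / (M.dim * (M.dim ^ 2 - 1))

/-- `C₂ = (d ‖O‖₂² - Tr(O)²) / (d (d² - 1))`. -/
noncomputable def coeffTwo : ℝ :=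
  (M.dim * M.normSqO - M.traceO ^ 2) / (M.dim * (M.dim ^ 2 - 1))

/-- The Kronecker symbol `δ_{ω,0}`. -/
noncomputable def delta (ω : ℝ) : ℝ := open Classical in if ω = 0 then 1 else 0

/-- The recursion over the layers, with weights `a l k` for the frequency `k` of layer `l`.
The term with index `m` belongs to the first `m + 1` layers. -/
noncomputable def layerRecursion (a : ℕ → ℝ → ℝ) : ℕ → ℝ → ℝ
  | 0, ω => delta ω / (M.dim + 1) + M.redundancy 1 1 ω / (M.dim * (M.dim + 1))
  | m + 1, ω =>
      ∑ k ∈ M.partialSpectrum (m + 2) (m + 2), a (m + 2) k * layerRecursion a m (ω - k)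
        + M.dim * delta ω / (M.dim ^ 2 - 1)
        - M.redundancy (m + 2) (m + 2) ω / (M.dim * (M.dim ^ 2 - 1))

/-- The exact weights `(|R_l(k)| - δ_{k,0}) / (d² - 1)`. -/
noncomputable def exactWeight (l : ℕ) (k : ℝ) : ℝ :=
  (M.redundancy l l k - delta k) / (M.dim ^ 2 - 1)

/-- The approximate weights `|R_l(k)| / (d² - 1)`. -/
noncomputable def approxWeight (l : ℕ) (k : ℝ) : ℝ :=
  M.redundancy l l k / (M.dim ^ 2 - 1)

/-- The closed form of the variance: a weighted combination of partial redundancies. Here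
`|R_2^1(ω)| = δ_{ω,0}`, and `L + 2 - j` does not truncate since `j ≤ L`. -/
noncomputable def approxVariance (ω : ℝ) : ℝ :=
  M.coeffTwo *
    ((M.redundancy 1 L ω - M.redundancy 2 L ω)
        / (M.dim * (M.dim + 1) * (M.dim ^ 2 - 1) ^ (L - 1))
      + ∑ j ∈ Finset.Icc 3 L,
          M.redundancy j L ω / (M.dim * (M.dim ^ 2 - 1) ^ (L + 2 - j))
      + if 2 ≤ L then delta ω / (M.dim * (M.dim ^ 2 - 1)) else 0)

end ReuploadingModel

/-- The variance `E |X - E X|²` of a complex random variable. -/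
noncomputable def complexVariance {Θ : Type*} [MeasurableSpace Θ] (μ : MeasureTheory.Measure Θ)
    (X : Θ → ℂ) : ℝ :=
  ∫ θ, ‖X θ - ∫ η, X η ∂μ‖ ^ 2 ∂μ

/-! Write `c_ω = Tr(O W ρ_ω W†)` with `W = W^{L+1}`, where `ρ_ω` is the part of frequency `ω` of the
state `|0⟩⟨0|` propagated through the `L` encoding layers (`fourierCoeff_eq_trace`). One layer acts
by `ρ^{m+1}_ω = ∑_{j,j'} P_{j'} W ρ^m_{ω-(λ_j-λ_{j'})} W† P_j`, and the trace of `ρ^m_ω` is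
`δ_{ω,0}` whatever the unitaries are.

The second moment of `W X W†` under a 2-design is a unitarily invariant tensor, hence a combination
of two contractions (`exists_coeff`). For `X = ρ^m_ω`, contracted with its own adjoint, the
coefficients depend only on `Tr X` and `Tr X X†`. Since the layers are independent, `E‖ρ^m_ω‖₂²`
obeys a closed linear recursion in `m`. Removing the contribution `δ_{ω,0}/d` of the trace makes it
homogeneous: with `D f(ω) = ∑_{j,j'} f(ω-(λ_j-λ_{j'}))`, taken for the eigenvalues of the new layer,
the remainder satisfies `V_0 = (1-1/d) δ` and `V_{m+1} = (D V_m - V_m)/(d²-1)`. A last 2-design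
average against `O` gives `Var c_ω = C₂ V_L(ω)`.

The approximate weights drop the subtracted term: `A_1 = V_1` and `A_{m+1} = (D A_m + δ/d)/(d²-1)`.
Iterating `D` on `δ` counts pairs of partial paths, so unrolling this recursion gives the closed
form. The error estimates use two properties of `D` on nonnegative functions. Pointwise `D f ≥ d f`,
because the `d` differences with `j = j'` vanish, so each dropped term costs a relative error of at
most `1/d`. And `D` multiplies total mass by `d²`, so `V_m` keeps the mass `1-1/d` while `A_m` has
the mass `(d²/(d²-1))^{m-1} - 1/d`. As `A ≥ V`, the summed error is the difference of the masses. -/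

open MeasureTheory

/-! ### Integration of continuous functions on the compact unitary group -/

instance matrixSecondCountableTopology (d : ℕ) :
    SecondCountableTopology (Matrix (Fin d) (Fin d) ℂ) :=
  inferInstanceAs (SecondCountableTopology (Fin d → Fin d → ℂ))

instance unitaryGroupSecondCountableTopology (d : ℕ) :
    SecondCountableTopology (Matrix.unitaryGroup (Fin d) ℂ) :=
  TopologicalSpace.Subtype.secondCountableTopology
    (Matrix.unitaryGroup (Fin d) ℂ : Set (Matrix (Fin d) (Fin d) ℂ))

instance unitaryHaar_isMulLeftInvariant (d : ℕ) : (unitaryHaar d).IsMulLeftInvariant := by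
  unfold unitaryHaar; infer_instance

instance unitaryHaar_isProbabilityMeasure (d : ℕ) : IsProbabilityMeasure (unitaryHaar d) :=
  ⟨by simpa [unitaryHaar] using
    Measure.haarMeasure_self (K₀ := (⊤ : TopologicalSpace.PositiveCompacts
      (Matrix.unitaryGroup (Fin d) ℂ)))⟩

/-- A continuous function on a compact space is bounded. All random quantities below are continuous
in finitely many unitaries, so this settles every integrability question. -/
theorem Continuous.integrable_comp_of_compactSpace {Θ X E : Type*} [MeasurableSpace Θ]
    {μ : Measure Θ} [IsFiniteMeasure μ] [TopologicalSpace X] [CompactSpace X] [MeasurableSpace X]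
    [BorelSpace X] [NormedAddCommGroup E] [SecondCountableTopology E] {g : X → E}
    (hg : Continuous g) {W : Θ → X} (hW : Measurable W) :
    Integrable (fun θ => g (W θ)) μ := by
  borelize E
  obtain ⟨C, hC⟩ := isCompact_univ.exists_bound_of_continuousOn hg.continuousOn
  exact Integrable.of_bound ((hg.measurable.comp hW).aestronglyMeasurable) C
    (Filter.Eventually.of_forall fun θ => hC _ (Set.mem_univ _))

theorem Continuous.memLp_comp_of_compactSpace {Θ X E : Type*} [MeasurableSpace Θ]
    {μ : Measure Θ} [IsFiniteMeasure μ] [TopologicalSpace X] [CompactSpace X] [MeasurableSpace X]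
    [BorelSpace X] [NormedAddCommGroup E] [SecondCountableTopology E] {g : X → E}
    (hg : Continuous g) {W : Θ → X} (hW : Measurable W) (p : ENNReal) :
    MemLp (fun θ => g (W θ)) p μ := by
  borelize E
  obtain ⟨C, hC⟩ := isCompact_univ.exists_bound_of_continuousOn hg.continuousOn
  exact MemLp.of_bound ((hg.measurable.comp hW).aestronglyMeasurable) C
    (Filter.Eventually.of_forall fun θ => hC _ (Set.mem_univ _))

/-! ### Four-index tensors invariant under unitary conjugation -/

section Invariants

variable {d : ℕ}

/-- Invariance of a four-index tensor under `U ⊗ Ū ⊗ Ū ⊗ U` for all unitaries `U`. -/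
def IsUnitarilyInvariant (T : Fin d → Fin d → Fin d → Fin d → ℂ) : Prop :=
  ∀ U ∈ Matrix.unitaryGroup (Fin d) ℂ, ∀ a b c e,
    T a b c e = ∑ x, U a x * ∑ y, star (U b y) * ∑ z, star (U c z) * ∑ w, U e w * T x y z w

namespace IsUnitarilyInvariant

variable {T : Fin d → Fin d → Fin d → Fin d → ℂ}

/-- Invariance under the diagonal unitary with `i` at position `x` and `1` elsewhere. The phase `-1`
would not suffice: it cannot see an index that occurs twice, such as `a = e`, where `i² = -1` still
differs from `1`. -/
theorem phase (hT : IsUnitarilyInvariant T) (x a b c e : Fin d) :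
    T a b c e = (if a = x then Complex.I else 1) * ((if b = x then -Complex.I else 1) *
      ((if c = x then -Complex.I else 1) * ((if e = x then Complex.I else 1) * T a b c e))) := by
  have hU : Matrix.diagonal (fun y : Fin d => if y = x then Complex.I else 1) ∈
      Matrix.unitaryGroup (Fin d) ℂ := by
    rw [Matrix.mem_unitaryGroup_iff, Matrix.star_eq_conjTranspose,
      Matrix.diagonal_conjTranspose, Matrix.diagonal_mul_diagonal, ← Matrix.diagonal_one]
    congr 1; ext y; by_cases h : y = x <;> simp [h]
  have h := hT _ hU a b c e
  simp only [Matrix.diagonal_apply, ite_mul, zero_mul, apply_ite (star : ℂ → ℂ), star_zero,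
    Finset.sum_ite_eq, Finset.mem_univ, if_true] at h
  refine h.trans ?_
  split_ifs <;> simp

/-- Unless the unconjugated indices `a, e` match the conjugated ones `b, c`, some diagonal phase
multiplies the entry by a scalar different from `1`. -/
theorem eq_zero (hT : IsUnitarilyInvariant T) {a b c e : Fin d} (h1 : ¬ (a = b ∧ c = e))
    (h2 : ¬ (a = c ∧ b = e)) : T a b c e = 0 := by
  have key : ∀ z t : ℂ, t = z * t → z ≠ 1 → t = 0 := fun z t h hz => by
    have : (1 - z) * t = 0 := by linear_combination h
    rcases mul_eq_zero.1 this with h | h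
    · exact absurd (sub_eq_zero.1 h).symm hz
    · exact h
  have hI : Complex.I ≠ 1 := fun h => by simpa using congrArg Complex.re h
  have hI' : -Complex.I ≠ 1 := fun h => by simpa using congrArg Complex.re h
  have hm : (-1 : ℂ) ≠ 1 := by norm_num
  by_cases hab : a = b
  · subst hab
    have hce : c ≠ e := fun h => h1 ⟨rfl, h⟩
    have h := hT.phase c a a c e
    refine key (-Complex.I) _ ?_ hI'
    by_cases hac : a = c
    · simp only [hac, hce.symm, if_true, if_false] at h ⊢
      ring_nf at h ⊢
      simpa [pow_succ] using h
    · simpa [hac, hce.symm] using h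
  · by_cases hac : a = c
    · subst hac
      have hbe : b ≠ e := fun h => h2 ⟨rfl, h⟩
      have h := hT.phase b a b a e
      exact key (-Complex.I) _ (by simpa [hab, hbe.symm] using h) hI'
    · have h := hT.phase a a b c e
      by_cases hae : e = a
      · exact key (-1) _ (by simpa [hae, Ne.symm hab, Ne.symm hac, ← mul_assoc] using h) hm
      · exact key Complex.I _ (by simpa [hae, Ne.symm hab, Ne.symm hac] using h) hI

theorem perm (hT : IsUnitarilyInvariant T) (s : Equiv.Perm (Fin d)) (a b c e : Fin d) :
    T a b c e = T (s a) (s b) (s c) (s e) := by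
  have hU : (Matrix.of fun x y : Fin d => if s x = y then (1 : ℂ) else 0) ∈
      Matrix.unitaryGroup (Fin d) ℂ := by
    rw [Matrix.mem_unitaryGroup_iff]
    ext x y
    simp [Matrix.mul_apply, Matrix.one_apply, apply_ite (star : ℂ → ℂ), eq_comm]
  have h := hT _ hU a b c e
  simpa [apply_ite (star : ℂ → ℂ)] using h

/-- Phases and permutations leave three free constants: all indices equal, and the two pairings of
distinct indices. A unitary mixing two basis vectors supplies the missing linear relation. -/
theorem reflection (hT : IsUnitarilyInvariant T) {a c : Fin d} (hac : a ≠ c) :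
    T a a a a = (3 / 5) ^ 4 * T a a a a + (4 / 5) ^ 4 * T c c c c +
      (12 / 25) ^ 2 * (T a a c c + T c c a a + T a c a c + T c a c a) := by
  -- The Householder reflection along `e_a + 2 e_c` is real and rational, and its row `a` is `(3/5,
  -- -4/5)`.
  let v : Fin d → ℂ := fun x => if x = a then 1 else if x = c then 2 else 0
  have hv : v ⬝ᵥ v = 5 := by
    have : ∀ x, v x * v x = (if x = a then 1 else 0) + (if x = c then 4 else 0) := by
      intro x
      by_cases h : x = a
      · simp [v, h, hac]
      · by_cases h' : x = c <;> simp [v, h, h', Ne.symm hac]; norm_num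
    simp only [dotProduct, this, Finset.sum_add_distrib, Finset.sum_ite_eq', Finset.mem_univ,
      if_true]
    norm_num
  have hU : (1 - (2 / 5 : ℂ) • Matrix.vecMulVec v v) ∈ Matrix.unitaryGroup (Fin d) ℂ := by
    have hs : star (Matrix.vecMulVec v v) = Matrix.vecMulVec v v := by
      ext x y
      simp only [Matrix.star_apply, Matrix.vecMulVec_apply, v]
      split_ifs <;> simp
    have h2 : Matrix.vecMulVec v v * Matrix.vecMulVec v v = (5 : ℂ) • Matrix.vecMulVec v v := by
      rw [Matrix.vecMulVec_mul_vecMulVec, hv]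
      ext x y
      simp [Matrix.vecMulVec_apply]
      ring
    rw [Matrix.mem_unitaryGroup_iff, star_sub, star_one, star_smul, hs]
    rw [mul_sub, sub_mul, sub_mul, smul_mul_smul_comm, h2]
    ext x y
    simp
    ring
  have hrow : ∀ f : Fin d → ℂ,
      ∑ x, (1 - (2 / 5 : ℂ) • Matrix.vecMulVec v v) a x * f x = 3 / 5 * f a - 4 / 5 * f c := by
    intro f
    have : ∀ x, (1 - (2 / 5 : ℂ) • Matrix.vecMulVec v v) a x * f x =
        (if x = a then 3 / 5 * f x else 0) + (if x = c then - (4 / 5) * f x else 0) := by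
      intro x
      by_cases h : x = a
      · simp [v, h, hac, Matrix.vecMulVec_apply]; norm_num
      · by_cases h' : x = c <;>
          simp [v, h, h', Ne.symm hac, Matrix.vecMulVec_apply, hac, Ne.symm h]; norm_num
    simp only [this, Finset.sum_add_distrib, Finset.sum_ite_eq', Finset.mem_univ, if_true]
    ring
  have hstar : ∀ x, star ((1 - (2 / 5 : ℂ) • Matrix.vecMulVec v v) a x) =
      (1 - (2 / 5 : ℂ) • Matrix.vecMulVec v v) a x := by
    intro x
    simp only [Matrix.sub_apply, Matrix.smul_apply, Matrix.vecMulVec_apply, Matrix.one_apply, v]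
    split_ifs <;> simp
  have h := hT _ hU a a a a
  simp only [hstar, hrow] at h
  have z := fun x y p q h1 h2 => hT.eq_zero (a := x) (b := y) (c := p) (e := q) h1 h2
  -- Of the sixteen entries with indices in `{a, c}`, these ten match neither pairing and vanish.
  simp only [z a a a c (by simp [hac]) (by simp [hac]), z a a c a (by simp [hac.symm]) (by simp [hac]),
    z a c a a (by simp [hac]) (by simp [hac.symm]), z c a a a (by simp [hac.symm]) (by simp [hac.symm]),
    z a c c a (by simp [hac]) (by simp [hac]), z c a a c (by simp [hac.symm]) (by simp [hac.symm]),
    z c c c a (by simp [hac.symm]) (by simp [hac.symm]), z c c a c (by simp [hac]) (by simp [hac.symm]),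
    z c a c c (by simp [hac.symm]) (by simp [hac]), z a c c c (by simp [hac]) (by simp [hac])] at h
  linear_combination h

/-- The unitarily invariant four-index tensors are spanned by two contractions. -/
theorem exists_coeff (hT : IsUnitarilyInvariant T) (hd : 2 ≤ d) :
    ∃ α β : ℂ, ∀ a b c e, T a b c e =
      α * (if a = b then 1 else 0) * (if c = e then 1 else 0) +
        β * (if a = c then 1 else 0) * (if b = e then 1 else 0) := by
  let i₀ : Fin d := ⟨0, by omega⟩
  let i₁ : Fin d := ⟨1, by omega⟩
  have h01 : i₀ ≠ i₁ := by simp [i₀, i₁]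
  have hperm : ∀ a c : Fin d, a ≠ c → ∃ s : Equiv.Perm (Fin d), s a = i₀ ∧ s c = i₁ := by
    intro a c hac
    refine ⟨Equiv.swap (Equiv.swap a i₀ c) i₁ * Equiv.swap a i₀, ?_, ?_⟩
    · rw [Equiv.Perm.mul_apply, Equiv.swap_apply_left, Equiv.swap_apply_of_ne_of_ne _ h01]
      intro h
      have := congrArg (Equiv.swap a i₀) h
      rw [Equiv.swap_apply_right, Equiv.swap_apply_self] at this
      exact hac this
    · simp
  have hsame : ∀ a, T a a a a = T i₀ i₀ i₀ i₀ := fun a => by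
    simpa using hT.perm (Equiv.swap a i₀) a a a a
  have hpair : ∀ a c, a ≠ c → T a a c c = T i₀ i₀ i₁ i₁ := fun a c hac => by
    obtain ⟨s, h1, h2⟩ := hperm a c hac
    simpa [h1, h2] using hT.perm s a a c c
  have hcross : ∀ a c, a ≠ c → T a c a c = T i₀ i₁ i₀ i₁ := fun a c hac => by
    obtain ⟨s, h1, h2⟩ := hperm a c hac
    simpa [h1, h2] using hT.perm s a c a c
  -- `1 - (3/5)⁴ - (4/5)⁴ = 288/625` equals `2 (12/25)²`, so the reflection identity reduces to this
  -- relation.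
  have hrel : T i₀ i₀ i₀ i₀ = T i₀ i₀ i₁ i₁ + T i₀ i₁ i₀ i₁ := by
    have h := hT.reflection h01
    rw [hsame i₁, hpair i₁ i₀ h01.symm, hcross i₁ i₀ h01.symm] at h
    linear_combination (625 / 288) * h
  refine ⟨T i₀ i₀ i₁ i₁, T i₀ i₁ i₀ i₁, fun a b c e => ?_⟩
  by_cases hab : a = b
  · subst hab
    by_cases hce : c = e
    · subst hce
      by_cases hac : a = c
      · subst hac
        simp [hsame a, hrel]
      · simp [hac, hpair a c hac]
    · rw [hT.eq_zero (by simp [hce]) (by rintro ⟨h1, h2⟩; exact hce (h1 ▸ h2))]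
      by_cases hac : a = c
      · subst hac; simp [hce]
      · simp [hac, hce]
  · by_cases hac : a = c
    · subst hac
      by_cases hbe : b = e
      · subst hbe; simp [hab, hcross a b hab]
      · rw [hT.eq_zero (by simp [hab]) (by simp [hbe])]
        simp [hab, hbe]
    · rw [hT.eq_zero (by simp [hab]) (by simp [hac])]
      simp [hab, hac]

end IsUnitarilyInvariant

end Invariants

/-! ### Second moments of unitary 2-designs -/

section TwoDesign

variable {d : ℕ}

theorem sandwich_apply (w X : Matrix (Fin d) (Fin d) ℂ) (a b : Fin d) :
    (w * X * w.conjTranspose) a b = ∑ x, ∑ y, w a x * star (w b y) * X x y := by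
  simp only [Matrix.mul_apply, Matrix.conjTranspose_apply, Finset.sum_mul]
  rw [Finset.sum_comm]
  exact Finset.sum_congr rfl fun x _ => Finset.sum_congr rfl fun y _ => by ring

theorem continuous_sandwich_apply (X : Matrix (Fin d) (Fin d) ℂ) (a b : Fin d) :
    Continuous fun w : Matrix.unitaryGroup (Fin d) ℂ =>
      ((w : Matrix (Fin d) (Fin d) ℂ) * X * (w : Matrix (Fin d) (Fin d) ℂ).conjTranspose) a b := by
  refine Continuous.matrix_elem ?_ a b
  exact (continuous_subtype_val.matrix_mul continuous_const).matrix_mul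
    continuous_subtype_val.matrix_conjTranspose

/-- The second moment of the entries of `W X W†` against those of `W Y W†`. -/
noncomputable def pairMoment {Θ : Type*} [MeasurableSpace Θ] (μ : Measure Θ)
    (W : Θ → Matrix.unitaryGroup (Fin d) ℂ) (X Y : Matrix (Fin d) (Fin d) ℂ)
    (a b c e : Fin d) : ℂ :=
  ∫ θ, ((W θ : Matrix (Fin d) (Fin d) ℂ) * X * (W θ : Matrix (Fin d) (Fin d) ℂ).conjTranspose) a b *
    star (((W θ : Matrix (Fin d) (Fin d) ℂ) * Y *
      (W θ : Matrix (Fin d) (Fin d) ℂ).conjTranspose) c e) ∂μ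

theorem pairMoment_integrable {Θ : Type*} [MeasurableSpace Θ] {μ : Measure Θ} [IsFiniteMeasure μ]
    {W : Θ → Matrix.unitaryGroup (Fin d) ℂ} (hW : Measurable W) (X Y : Matrix (Fin d) (Fin d) ℂ)
    (a b c e : Fin d) :
    Integrable (fun θ => ((W θ : Matrix (Fin d) (Fin d) ℂ) * X *
      (W θ : Matrix (Fin d) (Fin d) ℂ).conjTranspose) a b *
    star (((W θ : Matrix (Fin d) (Fin d) ℂ) * Y *
      (W θ : Matrix (Fin d) (Fin d) ℂ).conjTranspose) c e)) μ :=
  Continuous.integrable_comp_of_compactSpace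
    ((continuous_sandwich_apply X a b).mul (continuous_sandwich_apply Y c e).star) hW

/-- The pair moment is linear in the second moment superoperator, so Haar averages may replace
2-design averages. The outer `star` swaps roles in the second factor: row `e` enters unconjugated
and row `c` conjugated, hence the index order. -/
theorem pairMoment_eq_secondMoment {Θ : Type*} [MeasurableSpace Θ] {μ : Measure Θ}
    [IsFiniteMeasure μ] {W : Θ → Matrix.unitaryGroup (Fin d) ℂ} (hW : Measurable W)
    (X Y : Matrix (Fin d) (Fin d) ℂ) (a b c e : Fin d) :
    pairMoment μ W X Y a b c e = ∑ x, ∑ y, ∑ z, ∑ t, X x y * star (Y z t) *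
      secondMoment μ W (((a, e), b), c) (((x, t), y), z) := by
  have hint : ∀ x y z t : Fin d, Integrable (fun θ => X x y * star (Y z t) *
      ((W θ : Matrix (Fin d) (Fin d) ℂ) ⊗ₖ (W θ : Matrix (Fin d) (Fin d) ℂ) ⊗ₖ
      (W θ : Matrix (Fin d) (Fin d) ℂ).map star ⊗ₖ
      (W θ : Matrix (Fin d) (Fin d) ℂ).map star) (((a, e), b), c) (((x, t), y), z)) μ := by
    intro x y z t
    refine Continuous.integrable_comp_of_compactSpace (g := fun w : Matrix.unitaryGroup (Fin d) ℂ =>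
      X x y * star (Y z t) * ((w : Matrix (Fin d) (Fin d) ℂ) ⊗ₖ (w : Matrix (Fin d) (Fin d) ℂ) ⊗ₖ
      (w : Matrix (Fin d) (Fin d) ℂ).map star ⊗ₖ
      (w : Matrix (Fin d) (Fin d) ℂ).map star) (((a, e), b), c) (((x, t), y), z)) ?_ hW
    have h : ∀ i j, Continuous fun w : Matrix.unitaryGroup (Fin d) ℂ =>
        (w : Matrix (Fin d) (Fin d) ℂ) i j := fun i j => continuous_subtype_val.matrix_elem i j
    simp only [Matrix.kroneckerMap_apply, Matrix.map_apply]
    exact continuous_const.mul ((((h a x).mul (h e t)).mul (h b y).star).mul (h c z).star)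
  simp only [secondMoment, Matrix.of_apply, ← integral_const_mul]
  simp only [← integral_finsetSum Finset.univ fun t _ => hint _ _ _ t]
  simp only [← integral_finsetSum Finset.univ fun z _ =>
    integrable_finsetSum Finset.univ fun t _ => hint _ _ z t]
  simp only [← integral_finsetSum Finset.univ fun y _ => integrable_finsetSum Finset.univ fun z _ =>
    integrable_finsetSum Finset.univ fun t _ => hint _ y z t]
  rw [← integral_finsetSum Finset.univ fun x _ => integrable_finsetSum Finset.univ fun y _ =>
    integrable_finsetSum Finset.univ fun z _ =>
    integrable_finsetSum Finset.univ fun t _ => hint x y z t]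
  unfold pairMoment
  congr 1 with θ
  simp only [sandwich_apply, Matrix.kroneckerMap_apply, Matrix.map_apply, star_sum, star_mul',
    star_star]
  rw [Finset.sum_mul_sum]
  refine Finset.sum_congr rfl fun x _ => ?_
  simp only [Finset.sum_mul_sum]
  rw [Finset.sum_comm]
  refine Finset.sum_congr rfl fun y _ => Finset.sum_congr rfl fun z _ =>
    Finset.sum_congr rfl fun t _ => by ring

/-- Left invariance of Haar measure: replacing `w` by `U w` conjugates both sandwiches by `U`. -/
theorem pairMoment_isUnitarilyInvariant (X Y : Matrix (Fin d) (Fin d) ℂ) :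
    IsUnitarilyInvariant (pairMoment (unitaryHaar d) id X Y) := by
  intro U hU a b c e
  have hint := pairMoment_integrable (μ := unitaryHaar d) measurable_id X Y
  have hinv : pairMoment (unitaryHaar d) id X Y a b c e =
      ∫ w : Matrix.unitaryGroup (Fin d) ℂ,
        (U * ((w : Matrix (Fin d) (Fin d) ℂ) * X * (w : Matrix (Fin d) (Fin d) ℂ).conjTranspose) *
          U.conjTranspose) a b *
        star ((U * ((w : Matrix (Fin d) (Fin d) ℂ) * Y *
          (w : Matrix (Fin d) (Fin d) ℂ).conjTranspose) * U.conjTranspose) c e) ∂unitaryHaar d := by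
    refine (integral_mul_left_eq_self (μ := unitaryHaar d)
      (fun w : Matrix.unitaryGroup (Fin d) ℂ =>
        ((w : Matrix (Fin d) (Fin d) ℂ) * X * (w : Matrix (Fin d) (Fin d) ℂ).conjTranspose) a b *
        star (((w : Matrix (Fin d) (Fin d) ℂ) * Y *
          (w : Matrix (Fin d) (Fin d) ℂ).conjTranspose) c e)) ⟨U, hU⟩).symm.trans ?_
    congr 1 with w
    simp only [Submonoid.coe_mul, Matrix.conjTranspose_mul, Matrix.mul_assoc]
  rw [hinv]
  simp only [pairMoment, ← integral_const_mul]
  simp only [← integral_finsetSum Finset.univ fun w _ => (hint _ _ _ w).const_mul _,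
    ← integral_const_mul]
  simp only [← integral_finsetSum Finset.univ fun z _ =>
    (integrable_finsetSum Finset.univ fun w _ => (hint _ _ z w).const_mul _).const_mul _,
    ← integral_const_mul]
  simp only [← integral_finsetSum Finset.univ fun y _ => (integrable_finsetSum Finset.univ fun z _ =>
    (integrable_finsetSum Finset.univ fun w _ => (hint _ y z w).const_mul _).const_mul _).const_mul _,
    ← integral_const_mul]
  rw [← integral_finsetSum Finset.univ fun x _ => (integrable_finsetSum Finset.univ fun y _ =>
    (integrable_finsetSum Finset.univ fun z _ =>
    (integrable_finsetSum Finset.univ fun w _ =>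
      (hint x y z w).const_mul _).const_mul _).const_mul _).const_mul _]
  congr 1 with w
  simp only [sandwich_apply U, star_sum, star_mul', star_star, id]
  rw [Finset.sum_mul_sum]
  refine Finset.sum_congr rfl fun x _ => ?_
  simp only [Finset.sum_mul_sum]
  simp only [Finset.mul_sum]
  rw [Finset.sum_comm]
  refine Finset.sum_congr rfl fun y _ => Finset.sum_congr rfl fun z _ =>
    Finset.sum_congr rfl fun t _ => by ring

theorem IsTwoDesign.pairMoment_eq_haar {Θ : Type*} [MeasurableSpace Θ] {μ : Measure Θ}
    [IsFiniteMeasure μ] {W : Θ → Matrix.unitaryGroup (Fin d) ℂ} (hW : Measurable W)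
    (hdes : IsTwoDesign μ W) (X Y : Matrix (Fin d) (Fin d) ℂ) :
    pairMoment μ W X Y = pairMoment (unitaryHaar d) id X Y := by
  ext a b c e
  rw [pairMoment_eq_secondMoment hW, pairMoment_eq_secondMoment measurable_id, hdes]

theorem unitaryGroup_conjTranspose_mul_self (w : Matrix.unitaryGroup (Fin d) ℂ) :
    (w : Matrix (Fin d) (Fin d) ℂ).conjTranspose * (w : Matrix (Fin d) (Fin d) ℂ) = 1 :=
  Matrix.mem_unitaryGroup_iff'.1 w.2

theorem unitaryGroup_mul_conjTranspose_self (w : Matrix.unitaryGroup (Fin d) ℂ) :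
    (w : Matrix (Fin d) (Fin d) ℂ) * (w : Matrix (Fin d) (Fin d) ℂ).conjTranspose = 1 :=
  Matrix.mem_unitaryGroup_iff.1 w.2

theorem trace_sandwich (w : Matrix.unitaryGroup (Fin d) ℂ) (X : Matrix (Fin d) (Fin d) ℂ) :
    ((w : Matrix (Fin d) (Fin d) ℂ) * X * (w : Matrix (Fin d) (Fin d) ℂ).conjTranspose).trace =
      X.trace := by
  rw [Matrix.trace_mul_comm, ← Matrix.mul_assoc, unitaryGroup_conjTranspose_mul_self,
    Matrix.one_mul]

theorem natCast_sq_sub_one_ne_zero (hd : 2 ≤ d) : (d : ℂ) ^ 2 - 1 ≠ 0 := by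
  have : d ^ 2 ≠ 1 := by nlinarith
  exact sub_ne_zero.2 (by exact_mod_cast this)

theorem IsTwoDesign.pairMoment_apply {Θ : Type*} [MeasurableSpace Θ] {μ : Measure Θ}
    [IsProbabilityMeasure μ] {W : Θ → Matrix.unitaryGroup (Fin d) ℂ} (hW : Measurable W)
    (hdes : IsTwoDesign μ W) (hd : 2 ≤ d) (X Y : Matrix (Fin d) (Fin d) ℂ) (a b c e : Fin d) :
    pairMoment μ W X Y a b c e =
      (d * (X.trace * star Y.trace) - (X * Y.conjTranspose).trace) / (d * (d ^ 2 - 1)) *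
        (if a = b then 1 else 0) * (if c = e then 1 else 0) +
      (d * (X * Y.conjTranspose).trace - X.trace * star Y.trace) / (d * (d ^ 2 - 1)) *
        (if a = c then 1 else 0) * (if b = e then 1 else 0) := by
  obtain ⟨α, β, h⟩ := (pairMoment_isUnitarilyInvariant X Y).exists_coeff hd
  rw [← hdes.pairMoment_eq_haar hW] at h
  have hint := pairMoment_integrable (μ := μ) hW X Y
  -- The two unknown coefficients are found from the two full contractions, whose integrands `Tr X ·
  -- conj (Tr Y)` and `Tr (X Y†)` do not depend on the unitary. The resulting 2×2 system is
  -- invertible because `d² ≠ 1`.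
  have h1 : X.trace * star Y.trace = α * d ^ 2 + β * d := by
    calc X.trace * star Y.trace = ∑ a, ∑ c, pairMoment μ W X Y a a c c := by
          simp only [pairMoment]
          simp only [← integral_finsetSum Finset.univ fun c _ => hint _ _ c c]
          rw [← integral_finsetSum Finset.univ fun a _ =>
            integrable_finsetSum Finset.univ fun c _ => hint a a c c]
          have : ∀ θ, X.trace * star Y.trace =
              ∑ a, ∑ c, ((W θ : Matrix (Fin d) (Fin d) ℂ) * X *
                (W θ : Matrix (Fin d) (Fin d) ℂ).conjTranspose) a a *
                star (((W θ : Matrix (Fin d) (Fin d) ℂ) * Y *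
                (W θ : Matrix (Fin d) (Fin d) ℂ).conjTranspose) c c) := by
            intro θ
            rw [← Finset.sum_mul_sum, ← star_sum]
            rw [← trace_sandwich (W θ) X, ← trace_sandwich (W θ) Y]
            rfl
          simp only [← this]
          simp
      _ = α * d ^ 2 + β * d := by
          simp [h, Finset.sum_add_distrib]
          ring
  have h2 : (X * Y.conjTranspose).trace = α * d + β * d ^ 2 := by
    calc (X * Y.conjTranspose).trace = ∑ a, ∑ b, pairMoment μ W X Y a b a b := by
          simp only [pairMoment]
          simp only [← integral_finsetSum Finset.univ fun b _ => hint _ b _ b]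
          rw [← integral_finsetSum Finset.univ fun a _ =>
            integrable_finsetSum Finset.univ fun b _ => hint a b a b]
          have : ∀ θ, (X * Y.conjTranspose).trace =
              ∑ a, ∑ b, ((W θ : Matrix (Fin d) (Fin d) ℂ) * X *
                (W θ : Matrix (Fin d) (Fin d) ℂ).conjTranspose) a b *
                star (((W θ : Matrix (Fin d) (Fin d) ℂ) * Y *
                (W θ : Matrix (Fin d) (Fin d) ℂ).conjTranspose) a b) := by
            intro θ
            rw [← trace_sandwich (W θ) (X * Y.conjTranspose)]
            have : (W θ : Matrix (Fin d) (Fin d) ℂ) * (X * Y.conjTranspose) *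
                (W θ : Matrix (Fin d) (Fin d) ℂ).conjTranspose =
                ((W θ : Matrix (Fin d) (Fin d) ℂ) * X *
                (W θ : Matrix (Fin d) (Fin d) ℂ).conjTranspose) *
                ((W θ : Matrix (Fin d) (Fin d) ℂ) * Y *
                (W θ : Matrix (Fin d) (Fin d) ℂ).conjTranspose).conjTranspose := by
              simp only [Matrix.conjTranspose_mul, Matrix.conjTranspose_conjTranspose]
              simp only [Matrix.mul_assoc]
              rw [← Matrix.mul_assoc (W θ : Matrix (Fin d) (Fin d) ℂ).conjTranspose
                (W θ : Matrix (Fin d) (Fin d) ℂ), unitaryGroup_conjTranspose_mul_self,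
                Matrix.one_mul]
            rw [this]
            generalize (W θ : Matrix (Fin d) (Fin d) ℂ) * X *
              (W θ : Matrix (Fin d) (Fin d) ℂ).conjTranspose = A
            generalize (W θ : Matrix (Fin d) (Fin d) ℂ) * Y *
              (W θ : Matrix (Fin d) (Fin d) ℂ).conjTranspose = B
            simp [Matrix.trace, Matrix.mul_apply]
          simp only [← this]
          simp
      _ = α * d + β * d ^ 2 := by
          simp [h, Finset.sum_add_distrib]
          ring
  have hd0 : (d : ℂ) ≠ 0 := by exact_mod_cast (by omega : d ≠ 0)
  have hd1 := natCast_sq_sub_one_ne_zero hd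
  have hα : α = (d * (X.trace * star Y.trace) - (X * Y.conjTranspose).trace) /
      (d * (d ^ 2 - 1)) := by
    rw [h1, h2]; field_simp; ring
  have hβ : β = (d * (X * Y.conjTranspose).trace - X.trace * star Y.trace) /
      (d * (d ^ 2 - 1)) := by
    rw [h1, h2]; field_simp; ring
  rw [h, hα, hβ]

/-- The overlap second moment of a 2-design. -/
theorem IsTwoDesign.integral_trace_mul {Θ : Type*} [MeasurableSpace Θ] {μ : Measure Θ}
    [IsProbabilityMeasure μ] {W : Θ → Matrix.unitaryGroup (Fin d) ℂ} (hW : Measurable W)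
    (hdes : IsTwoDesign μ W) (hd : 2 ≤ d) (Q X Y : Matrix (Fin d) (Fin d) ℂ) :
    ∫ θ, (Q * ((W θ : Matrix (Fin d) (Fin d) ℂ) * X *
        (W θ : Matrix (Fin d) (Fin d) ℂ).conjTranspose)).trace *
      star (Q * ((W θ : Matrix (Fin d) (Fin d) ℂ) * Y *
        (W θ : Matrix (Fin d) (Fin d) ℂ).conjTranspose)).trace ∂μ =
      (d * (X.trace * star Y.trace) - (X * Y.conjTranspose).trace) / (d * (d ^ 2 - 1)) *
        (Q.trace * star Q.trace) +
      (d * (X * Y.conjTranspose).trace - X.trace * star Y.trace) / (d * (d ^ 2 - 1)) *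
        (Q * Q.conjTranspose).trace := by
  have hint := pairMoment_integrable (μ := μ) hW X Y
  have hexp : ∀ θ, (Q * ((W θ : Matrix (Fin d) (Fin d) ℂ) * X *
        (W θ : Matrix (Fin d) (Fin d) ℂ).conjTranspose)).trace *
      star (Q * ((W θ : Matrix (Fin d) (Fin d) ℂ) * Y *
        (W θ : Matrix (Fin d) (Fin d) ℂ).conjTranspose)).trace =
      ∑ b, ∑ e, ∑ a, ∑ c, Q b a * star (Q e c) * (((W θ : Matrix (Fin d) (Fin d) ℂ) * X *
        (W θ : Matrix (Fin d) (Fin d) ℂ).conjTranspose) a b *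
        star (((W θ : Matrix (Fin d) (Fin d) ℂ) * Y *
        (W θ : Matrix (Fin d) (Fin d) ℂ).conjTranspose) c e)) := by
    intro θ
    generalize (W θ : Matrix (Fin d) (Fin d) ℂ) * X *
        (W θ : Matrix (Fin d) (Fin d) ℂ).conjTranspose = A
    generalize (W θ : Matrix (Fin d) (Fin d) ℂ) * Y *
        (W θ : Matrix (Fin d) (Fin d) ℂ).conjTranspose = B
    simp only [Matrix.trace, Matrix.diag_apply, Matrix.mul_apply, star_sum, star_mul',
      Finset.sum_mul_sum]
    exact Finset.sum_congr rfl fun b _ => Finset.sum_congr rfl fun e _ =>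
      Finset.sum_congr rfl fun a _ => Finset.sum_congr rfl fun c _ => by ring
  simp only [hexp]
  rw [integral_finsetSum Finset.univ fun b _ => integrable_finsetSum Finset.univ fun e _ =>
    integrable_finsetSum Finset.univ fun a _ => integrable_finsetSum Finset.univ fun c _ =>
      (hint a b c e).const_mul _]
  simp only [integral_finsetSum Finset.univ fun e _ => integrable_finsetSum Finset.univ fun a _ =>
    integrable_finsetSum Finset.univ fun c _ => (hint a _ c e).const_mul _]
  simp only [integral_finsetSum Finset.univ fun a _ =>
    integrable_finsetSum Finset.univ fun c _ => (hint a _ c _).const_mul _]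
  simp only [integral_finsetSum Finset.univ fun c _ => (hint _ _ c _).const_mul _,
    integral_const_mul]
  have hpm : ∀ a b c e, ∫ θ, ((W θ : Matrix (Fin d) (Fin d) ℂ) * X *
        (W θ : Matrix (Fin d) (Fin d) ℂ).conjTranspose) a b *
        star (((W θ : Matrix (Fin d) (Fin d) ℂ) * Y *
        (W θ : Matrix (Fin d) (Fin d) ℂ).conjTranspose) c e) ∂μ = _ :=
    hdes.pairMoment_apply hW hd X Y
  simp only [hpm]
  generalize (d * (X.trace * star Y.trace) - (X * Y.conjTranspose).trace) /
    ((d : ℂ) * (d ^ 2 - 1)) = α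
  generalize (d * (X * Y.conjTranspose).trace - X.trace * star Y.trace) /
    ((d : ℂ) * (d ^ 2 - 1)) = β
  simp only [mul_add, Finset.sum_add_distrib, mul_ite, mul_one, mul_zero]
  congr 1
  · rw [Matrix.trace, star_sum, Finset.sum_mul_sum, Finset.mul_sum]
    simp only [Finset.mul_sum, Finset.sum_ite_eq', Finset.mem_univ, if_true,
      Matrix.diag_apply]
    exact Finset.sum_congr rfl fun b _ => Finset.sum_congr rfl fun e _ => by simp; ring
  · simp [Finset.sum_ite_eq, Matrix.trace, Matrix.mul_apply, Finset.mul_sum]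
    exact Finset.sum_congr rfl fun b _ => Finset.sum_congr rfl fun e _ => by ring

/-- The first moment of a 2-design. -/
theorem IsTwoDesign.integral_trace {Θ : Type*} [MeasurableSpace Θ] {μ : Measure Θ}
    [IsProbabilityMeasure μ] {W : Θ → Matrix.unitaryGroup (Fin d) ℂ} (hW : Measurable W)
    (hdes : IsTwoDesign μ W) (hd : 2 ≤ d) (Q X : Matrix (Fin d) (Fin d) ℂ) :
    ∫ θ, (Q * ((W θ : Matrix (Fin d) (Fin d) ℂ) * X *
        (W θ : Matrix (Fin d) (Fin d) ℂ).conjTranspose)).trace ∂μ =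
      X.trace * Q.trace / d := by
  have hd0 : (d : ℂ) ≠ 0 := by exact_mod_cast (by omega : d ≠ 0)
  have hd1 := natCast_sq_sub_one_ne_zero hd
  have hm : ∀ a b, ∫ θ, ((W θ : Matrix (Fin d) (Fin d) ℂ) * X *
        (W θ : Matrix (Fin d) (Fin d) ℂ).conjTranspose) a b ∂μ =
        X.trace / d * (if a = b then 1 else 0) := by
    intro a b
    let c : Fin d := ⟨0, by omega⟩
    -- With `Y = 1` the second factor is the diagonal entry `(W W†)_{cc} = 1`, so the second moment
    -- contains the first.
    have h := hdes.pairMoment_apply hW hd X 1 a b c c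
    simp only [pairMoment, Matrix.mul_one, unitaryGroup_mul_conjTranspose_self] at h
    simp only [Matrix.one_apply_eq, star_one, mul_one, Matrix.conjTranspose_one, Matrix.trace_one,
      Fintype.card_fin, star_natCast, if_true] at h
    rw [h, mul_comm X.trace, sub_self, zero_div, zero_mul, zero_mul, add_zero]
    congr 1
    field_simp
  have hint : ∀ a b, Integrable (fun θ => ((W θ : Matrix (Fin d) (Fin d) ℂ) * X *
        (W θ : Matrix (Fin d) (Fin d) ℂ).conjTranspose) a b) μ := fun a b =>
    Continuous.integrable_comp_of_compactSpace (continuous_sandwich_apply X a b) hW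
  have hexp : ∀ θ, (Q * ((W θ : Matrix (Fin d) (Fin d) ℂ) * X *
        (W θ : Matrix (Fin d) (Fin d) ℂ).conjTranspose)).trace =
      ∑ b, ∑ a, Q b a * ((W θ : Matrix (Fin d) (Fin d) ℂ) * X *
        (W θ : Matrix (Fin d) (Fin d) ℂ).conjTranspose) a b := by
    intro θ
    generalize (W θ : Matrix (Fin d) (Fin d) ℂ) * X *
        (W θ : Matrix (Fin d) (Fin d) ℂ).conjTranspose = A
    simp only [Matrix.trace, Matrix.diag_apply, Matrix.mul_apply]
  simp only [hexp]
  have hint' := fun b a => (hint a b).const_mul (Q b a)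
  rw [integral_finsetSum Finset.univ fun b _ => integrable_finsetSum Finset.univ fun a _ =>
    hint' b a]
  simp only [integral_finsetSum Finset.univ fun a _ => hint' _ a, integral_const_mul, hm]
  simp only [mul_ite, mul_one, mul_zero, Finset.sum_ite_eq', Finset.mem_univ, if_true]
  rw [← Finset.sum_mul]
  change Q.trace * _ = _
  ring

end TwoDesign

/-! ### Convolution with the difference multiset of a finite family of reals -/

namespace ReuploadingModel

section Profiles

variable {d : ℕ}

/-- The sum of the translates of `f` by all differences `x j - x j'`. -/
noncomputable def differenceConv (x : Fin d → ℝ) : (ℝ → ℝ) →ₗ[ℝ] (ℝ → ℝ) where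
  toFun f ω := ∑ j, ∑ j', f (ω - (x j - x j'))
  map_add' f g := by ext ω; simp [Finset.sum_add_distrib]
  map_smul' c f := by ext ω; simp [Finset.mul_sum]

theorem differenceConv_apply (x : Fin d → ℝ) (f : ℝ → ℝ) (ω : ℝ) :
    differenceConv x f ω = ∑ j, ∑ j', f (ω - (x j - x j')) := rfl

theorem differenceConv_nonneg (x : Fin d → ℝ) {f : ℝ → ℝ} (hf : ∀ ω, 0 ≤ f ω) (ω : ℝ) :
    0 ≤ differenceConv x f ω := by
  rw [differenceConv_apply]
  exact Finset.sum_nonneg fun _ _ => Finset.sum_nonneg fun _ _ => hf _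

theorem differenceConv_mono (x : Fin d → ℝ) {f g : ℝ → ℝ} (h : ∀ ω, f ω ≤ g ω) (ω : ℝ) :
    differenceConv x f ω ≤ differenceConv x g ω := by
  rw [differenceConv_apply, differenceConv_apply]
  exact Finset.sum_le_sum fun _ _ => Finset.sum_le_sum fun _ _ => h _

/-- The `d` pairs with `j = j'` have difference zero and each contribute `f ω`. -/
theorem mul_le_differenceConv (x : Fin d → ℝ) {f : ℝ → ℝ} (hf : ∀ ω, 0 ≤ f ω) (ω : ℝ) :
    d * f ω ≤ differenceConv x f ω := by
  calc (d : ℝ) * f ω = ∑ _j : Fin d, f ω := by simp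
    _ ≤ differenceConv x f ω := Finset.sum_le_sum fun j _ => by
        simpa using Finset.single_le_sum (f := fun j' => f (ω - (x j - x j')))
          (fun _ _ => hf _) (Finset.mem_univ j)

/-- Total mass is taken over all of `ℝ`, where translations preserve it; no spectrum has to be
tracked through the recursion. -/
theorem hasSum_differenceConv (x : Fin d → ℝ) {f : ℝ → ℝ} {s : ℝ} (hf : HasSum f s) :
    HasSum (differenceConv x f) (d ^ 2 * s) := by
  have h : HasSum (fun ω => ∑ j, ∑ j', f (ω - (x j - x j'))) (∑ _j : Fin d, ∑ _j' : Fin d, s) :=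
    hasSum_sum fun j _ => hasSum_sum fun j' _ =>
      (Equiv.subRight (x j - x j')).hasSum_iff.2 hf
  have e : (d : ℝ) ^ 2 * s = ∑ _j : Fin d, ∑ _j' : Fin d, s := by
    simp
    ring
  rw [e]
  exact h

theorem eq_zero_of_differenceConv_eq_zero {x : Fin d → ℝ} {r : ℝ → ℝ} (hr : ∀ ω, 0 ≤ r ω)
    {ω : ℝ} (h : differenceConv x r ω = 0) (j j' : Fin d) : r (ω - (x j - x j')) = 0 := by
  rw [differenceConv_apply,
    Finset.sum_eq_zero_iff_of_nonneg fun _ _ => Finset.sum_nonneg fun _ _ => hr _] at h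
  have h' := h j (Finset.mem_univ j)
  rw [Finset.sum_eq_zero_iff_of_nonneg fun _ _ => hr _] at h'
  exact h' j' (Finset.mem_univ j')

theorem differenceConv_eq_zero {x : Fin d → ℝ} {r f : ℝ → ℝ} (hr : ∀ ω, 0 ≤ r ω)
    (hrf : ∀ ω, r ω = 0 → f ω = 0) {ω : ℝ} (h : differenceConv x r ω = 0) :
    differenceConv x f ω = 0 := by
  rw [differenceConv_apply]
  exact Finset.sum_eq_zero fun j _ => Finset.sum_eq_zero fun j' _ =>
    hrf _ (eq_zero_of_differenceConv_eq_zero hr h j j')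

theorem delta_nonneg (ω : ℝ) : 0 ≤ delta ω := by unfold delta; split_ifs <;> norm_num

theorem delta_zero : delta 0 = 1 := by simp [delta]

theorem delta_of_ne_zero {ω : ℝ} (h : ω ≠ 0) : delta ω = 0 := by simp [delta, h]

theorem hasSum_delta : HasSum delta 1 := by
  simpa [delta_zero] using hasSum_single (f := delta) 0 fun _ h => delta_of_ne_zero h

/-! ### Exact and approximate variance profiles: positivity, comparison, mass and support -/

/-- The number of pairs of paths through the first `m` layers of a given frequency. -/
noncomputable def pathCount (x : ℕ → Fin d → ℝ) : ℕ → ℝ → ℝ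
  | 0 => delta
  | m + 1 => differenceConv (x m) (pathCount x m)

/-- The normalized variance after `m` layers. -/
noncomputable def varianceProfile (x : ℕ → Fin d → ℝ) : ℕ → ℝ → ℝ
  | 0 => (1 - 1 / (d : ℝ)) • delta
  | m + 1 => (1 / ((d : ℝ) ^ 2 - 1)) •
      (differenceConv (x m) (varianceProfile x m) - varianceProfile x m)

/-- The part of the approximate variance propagated from the first layer. -/
noncomputable def leadingProfile (x : ℕ → Fin d → ℝ) : ℕ → ℝ → ℝ
  | 0 => varianceProfile x 1
  | m + 1 => (1 / ((d : ℝ) ^ 2 - 1)) • differenceConv (x (m + 1)) (leadingProfile x m)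

/-- The part of the approximate variance created at zero frequency in the later layers. -/
noncomputable def sourceProfile (x : ℕ → Fin d → ℝ) : ℕ → ℝ → ℝ
  | 0 => 0
  | m + 1 => (1 / ((d : ℝ) ^ 2 - 1)) • differenceConv (x (m + 1)) (sourceProfile x m) +
      (1 / ((d : ℝ) * ((d : ℝ) ^ 2 - 1))) • delta

/-- The normalized approximate variance after `m + 1` layers. -/
noncomputable def approxProfile (x : ℕ → Fin d → ℝ) : ℕ → ℝ → ℝ
  | 0 => varianceProfile x 1
  | m + 1 => (1 / ((d : ℝ) ^ 2 - 1)) • differenceConv (x (m + 1)) (approxProfile x m) +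
      (1 / ((d : ℝ) * ((d : ℝ) ^ 2 - 1))) • delta

variable (x : ℕ → Fin d → ℝ)

theorem approxProfile_eq_add (m : ℕ) :
    approxProfile x m = leadingProfile x m + sourceProfile x m := by
  induction m with
  | zero => simp [approxProfile, leadingProfile, sourceProfile]
  | succ m ih =>
    simp only [approxProfile, leadingProfile, sourceProfile, ih, map_add, smul_add]
    abel

theorem pathCount_nonneg (m : ℕ) : ∀ ω, 0 ≤ pathCount x m ω := by
  induction m with
  | zero => exact delta_nonneg
  | succ m ih => exact differenceConv_nonneg _ ih

variable (hd : 2 ≤ d)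
include hd

theorem one_lt_cast_sq : (1 : ℝ) < (d : ℝ) ^ 2 := by
  have : (2 : ℝ) ≤ d := by exact_mod_cast hd
  nlinarith

/-- Equal paths have frequency zero. This places the sources at frequency `0` of the approximate
recursion inside the spectrum. -/
theorem pathCount_zero_pos (m : ℕ) : 0 < pathCount x m 0 := by
  induction m with
  | zero => simp [pathCount, delta_zero]
  | succ m ih =>
    have h := mul_le_differenceConv (x m) (pathCount_nonneg x m) 0
    have : (2 : ℝ) ≤ d := by exact_mod_cast hd
    rw [pathCount]
    nlinarith

/-- The subtraction in the recursion is harmless because `D f ≥ d f ≥ f` for nonnegative `f`. -/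
theorem varianceProfile_nonneg (m : ℕ) : ∀ ω, 0 ≤ varianceProfile x m ω := by
  have hd2 : (2 : ℝ) ≤ d := by exact_mod_cast hd
  have hq := one_lt_cast_sq hd
  induction m with
  | zero =>
    intro ω
    have : 1 / (d : ℝ) ≤ 1 := by rw [div_le_one (by linarith)]; linarith
    exact mul_nonneg (sub_nonneg.2 this) (delta_nonneg ω)
  | succ m ih =>
    intro ω
    have h := mul_le_differenceConv (x m) ih ω
    have := ih ω
    exact mul_nonneg (by rw [one_div_nonneg]; linarith)
      (by simp only [Pi.sub_apply]; nlinarith)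

theorem sourceProfile_nonneg (m : ℕ) : ∀ ω, 0 ≤ sourceProfile x m ω := by
  have hd2 : (2 : ℝ) ≤ d := by exact_mod_cast hd
  have hq := sub_pos.2 (one_lt_cast_sq hd)
  induction m with
  | zero => intro ω; simp [sourceProfile]
  | succ m ih =>
    intro ω
    exact add_nonneg (mul_nonneg (by positivity) (differenceConv_nonneg _ ih ω))
      (mul_nonneg (by positivity) (delta_nonneg ω))

theorem varianceProfile_le_leadingProfile (m : ℕ) :
    ∀ ω, varianceProfile x (m + 1) ω ≤ leadingProfile x m ω := by
  have hq := sub_pos.2 (one_lt_cast_sq hd)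
  induction m with
  | zero => exact fun _ => le_rfl
  | succ m ih =>
    intro ω
    rw [varianceProfile, leadingProfile]
    simp only [Pi.smul_apply, Pi.sub_apply, smul_eq_mul]
    have h1 := differenceConv_mono (x (m + 1)) ih ω
    have h2 := varianceProfile_nonneg x hd (m + 1) ω
    gcongr
    linarith

/-- Each layer adds `1/d` to the relative error: the old error is propagated by the positive
operator `D`, and the newly dropped term is at most the leading profile, hence at most `1/d` times
its image under `D`. -/
theorem leadingProfile_sub_le (m : ℕ) :
    ∀ ω, leadingProfile x m ω - varianceProfile x (m + 1) ω ≤ m / d * leadingProfile x m ω := by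
  have hd2 : (2 : ℝ) ≤ d := by exact_mod_cast hd
  have hq := sub_pos.2 (one_lt_cast_sq hd)
  induction m with
  | zero => intro ω; simp [leadingProfile]
  | succ m ih =>
    intro ω
    have hlead : ∀ ω, 0 ≤ leadingProfile x m ω := fun ω =>
      (varianceProfile_nonneg x hd (m + 1) ω).trans (varianceProfile_le_leadingProfile x hd m ω)
    have h1 : differenceConv (x (m + 1)) (leadingProfile x m) ω -
        differenceConv (x (m + 1)) (varianceProfile x (m + 1)) ω ≤
        m / d * differenceConv (x (m + 1)) (leadingProfile x m) ω := by
      have := differenceConv_mono (x (m + 1))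
        (f := leadingProfile x m - varianceProfile x (m + 1))
        (g := ((m : ℝ) / d) • leadingProfile x m) ih ω
      rwa [map_sub, map_smul] at this
    have h2 : varianceProfile x (m + 1) ω ≤
        1 / d * differenceConv (x (m + 1)) (leadingProfile x m) ω := by
      have := mul_le_differenceConv (x (m + 1)) hlead ω
      rw [one_div, ← div_eq_inv_mul, le_div_iff₀ (by linarith), mul_comm]
      have := varianceProfile_le_leadingProfile x hd m ω
      nlinarith
    rw [varianceProfile, leadingProfile]
    simp only [Pi.smul_apply, Pi.sub_apply, smul_eq_mul, ← mul_sub]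
    rw [mul_left_comm]
    refine mul_le_mul_of_nonneg_left ?_ (by positivity)
    push_cast
    rw [add_div, add_mul]
    linarith

/-- The mass is conserved: `D` multiplies it by `d²`, the subtraction removes it once, and the
division by `d² - 1` compensates. -/
theorem hasSum_varianceProfile (m : ℕ) : HasSum (varianceProfile x m) (1 - 1 / (d : ℝ)) := by
  have hq := sub_pos.2 (one_lt_cast_sq hd)
  induction m with
  | zero =>
    have h := hasSum_delta.const_smul (1 - 1 / (d : ℝ))
    rw [smul_eq_mul, mul_one] at h
    exact h
  | succ m ih =>
    have h := ((hasSum_differenceConv (x m) ih).sub ih).const_smul (1 / ((d : ℝ) ^ 2 - 1))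
    have e : 1 - 1 / (d : ℝ) =
        (1 / ((d : ℝ) ^ 2 - 1)) • ((d : ℝ) ^ 2 * (1 - 1 / d) - (1 - 1 / d)) := by
      rw [smul_eq_mul]
      field_simp
    rw [e]
    exact h

theorem hasSum_sourceProfile (m : ℕ) : HasSum (sourceProfile x m)
    ((((d : ℝ) ^ 2 / ((d : ℝ) ^ 2 - 1)) ^ m - 1) / d) := by
  have hq := sub_pos.2 (one_lt_cast_sq hd)
  have hd2 : (2 : ℝ) ≤ d := by exact_mod_cast hd
  induction m with
  | zero => 
    rw [pow_zero, sub_self, zero_div]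
    exact hasSum_zero
  | succ m ih =>
    have h := ((hasSum_differenceConv (x (m + 1)) ih).const_smul (1 / ((d : ℝ) ^ 2 - 1))).add
      (hasSum_delta.const_smul (1 / ((d : ℝ) * ((d : ℝ) ^ 2 - 1))))
    have e : ((((d : ℝ) ^ 2 / ((d : ℝ) ^ 2 - 1)) ^ (m + 1) - 1) / (d : ℝ)) =
        (1 / ((d : ℝ) ^ 2 - 1)) • ((d : ℝ) ^ 2 * ((((d : ℝ) ^ 2 / ((d : ℝ) ^ 2 - 1)) ^ m - 1) / (d : ℝ))) +
          (1 / ((d : ℝ) * ((d : ℝ) ^ 2 - 1))) • (1 : ℝ) := by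
      simp only [smul_eq_mul]
      rw [pow_succ]
      generalize ((d : ℝ) ^ 2 / ((d : ℝ) ^ 2 - 1)) ^ m = t
      field_simp
      ring
    rw [e]
    exact h

theorem hasSum_approxProfile (m : ℕ) : HasSum (approxProfile x m)
    (((d : ℝ) ^ 2 / ((d : ℝ) ^ 2 - 1)) ^ m - 1 / d) := by
  have hq := sub_pos.2 (one_lt_cast_sq hd)
  have hd2 : (2 : ℝ) ≤ d := by exact_mod_cast hd
  induction m with
  | zero => simpa [approxProfile] using hasSum_varianceProfile x hd 1
  | succ m ih =>
    have h := ((hasSum_differenceConv (x (m + 1)) ih).const_smul (1 / ((d : ℝ) ^ 2 - 1))).add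
      (hasSum_delta.const_smul (1 / ((d : ℝ) * ((d : ℝ) ^ 2 - 1))))
    have e : (((d : ℝ) ^ 2 / ((d : ℝ) ^ 2 - 1)) ^ (m + 1) - 1 / (d : ℝ)) =
        (1 / ((d : ℝ) ^ 2 - 1)) • ((d : ℝ) ^ 2 * (((d : ℝ) ^ 2 / ((d : ℝ) ^ 2 - 1)) ^ m - 1 / (d : ℝ))) +
          (1 / ((d : ℝ) * ((d : ℝ) ^ 2 - 1))) • (1 : ℝ) := by
      simp only [smul_eq_mul]
      rw [pow_succ]
      generalize ((d : ℝ) ^ 2 / ((d : ℝ) ^ 2 - 1)) ^ m = t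
      field_simp
      ring
    rw [e]
    exact h

theorem varianceProfile_le_approxProfile (m : ℕ) (ω : ℝ) :
    varianceProfile x (m + 1) ω ≤ approxProfile x m ω := by
  rw [approxProfile_eq_add]
  have h1 := varianceProfile_le_leadingProfile x hd m ω
  have h2 := sourceProfile_nonneg x hd m ω
  simp only [Pi.add_apply]
  linarith

/-- The leading part has a relative error bound, while the source part counts entirely as error and
is bounded at each frequency by its total mass. -/
theorem approxProfile_sub_le (m : ℕ) (ω : ℝ) :
    approxProfile x m ω - varianceProfile x (m + 1) ω ≤ m / d * approxProfile x m ω +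
      (((d : ℝ) ^ 2 / ((d : ℝ) ^ 2 - 1)) ^ m - 1) / d := by
  have h1 := leadingProfile_sub_le x hd m ω
  have h2 := sourceProfile_nonneg x hd m ω
  have h3 := le_hasSum (hasSum_sourceProfile x hd m) ω fun ω' _ => sourceProfile_nonneg x hd m ω'
  have h4 : 0 ≤ (m : ℝ) / d * sourceProfile x m ω := mul_nonneg (by positivity) h2
  rw [approxProfile_eq_add]
  simp only [Pi.add_apply]
  linarith

theorem varianceProfile_eq_zero (m : ℕ) : ∀ ω, pathCount x m ω = 0 → varianceProfile x m ω = 0 := by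
  induction m with
  | zero =>
    intro ω h
    simp only [pathCount] at h
    simp [varianceProfile, h]
  | succ m ih =>
    intro ω h
    have h1 := differenceConv_eq_zero (pathCount_nonneg x m) ih h
    -- Taking `j = j'` leaves the frequency unchanged, so `ω` carries no path pair one layer earlier
    -- either; this handles the subtracted term.
    have h2 := ih _ (eq_zero_of_differenceConv_eq_zero (pathCount_nonneg x m) h
      ⟨0, by omega⟩ ⟨0, by omega⟩)
    rw [sub_self, sub_zero] at h2
    simp [varianceProfile, h1, h2]

theorem approxProfile_eq_zero (m : ℕ) :
    ∀ ω, pathCount x (m + 1) ω = 0 → approxProfile x m ω = 0 := by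
  induction m with
  | zero => exact varianceProfile_eq_zero x hd 1
  | succ m ih =>
    intro ω h
    have h1 := differenceConv_eq_zero (pathCount_nonneg x (m + 1)) ih h
    have h2 : ω ≠ 0 := fun h0 => (pathCount_zero_pos x hd (m + 2)).ne' (h0 ▸ h)
    simp [approxProfile, h1, delta_of_ne_zero h2]

end Profiles

end ReuploadingModel

namespace ReuploadingModel

/-! ### Redundancies as iterated convolutions -/

section Redundancy

/-- The number of pairs of functions whose weighted difference is `ω`. -/
noncomputable def pairCount {B : Type*} [Fintype B] [DecidableEq B] {d : ℕ} (v : B → Fin d → ℝ) (ω : ℝ) : ℝ :=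
  ∑ p : B → Fin d, ∑ q : B → Fin d, delta (ω - ∑ b, (v b (p b) - v b (q b)))

theorem pairCount_congr {B : Type*} [Fintype B] [DecidableEq B] {C : Type*} [Fintype C]
    [DecidableEq C] {d : ℕ}
    (e : B ≃ C) (v : C → Fin d → ℝ) (ω : ℝ) :
    pairCount (v ∘ e) ω = pairCount v ω := by
  unfold pairCount
  refine Fintype.sum_equiv (e.arrowCongr (Equiv.refl _)) _ _ fun p => ?_
  refine Fintype.sum_equiv (e.arrowCongr (Equiv.refl _)) _ _ fun q => ?_
  congr 2
  exact Fintype.sum_equiv e _ _ fun b => by simp [Equiv.arrowCongr]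

theorem pairCount_of_isEmpty {B : Type*} [Fintype B] [DecidableEq B] [IsEmpty B] {d : ℕ}
    (v : B → Fin d → ℝ) :
    pairCount v = delta := by
  ext ω
  simp [pairCount]

theorem pairCount_option {B : Type*} [Fintype B] [DecidableEq B] {d : ℕ} (v : Option B → Fin d → ℝ) :
    pairCount v = differenceConv (v none) (pairCount fun b => v (some b)) := by
  ext ω
  rw [differenceConv_apply]
  unfold pairCount
  have hs : ∀ F : (Option B → Fin d) → ℝ, ∑ p, F p =
      ∑ j : Fin d, ∑ p : B → Fin d, F fun o => o.elim j p := by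
    intro F
    rw [← Fintype.sum_prod_type']
    exact Fintype.sum_equiv (Equiv.piOptionEquivProd (β := fun _ => Fin d)) _ _ fun p => by
      congr 1
      ext o
      cases o <;> rfl
  rw [hs]
  refine Finset.sum_congr rfl fun j _ => ?_
  simp only [hs]
  rw [Finset.sum_comm]
  refine Finset.sum_congr rfl fun j' _ => Finset.sum_congr rfl fun p _ =>
    Finset.sum_congr rfl fun q _ => ?_
  rw [Fintype.sum_option, sub_sub]
  rfl

variable {n L : ℕ} (M : ReuploadingModel n L)

/-- The eigenvalues of the layers indexed by natural numbers. -/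
noncomputable def layerEigenvalue (k : ℕ) (j : Fin (2 ^ n)) : ℝ :=
  if h : k < L then M.eigenvalue ⟨k, h⟩ j else 0

theorem layerEigenvalue_val (k : Fin L) : M.layerEigenvalue k = M.eigenvalue k := by
  ext j; simp [layerEigenvalue]

theorem redundancy_eq_pairCount (h l : ℕ) : M.redundancy h l =
    pairCount fun k : LayerRange L h l => M.layerEigenvalue k.1 := by
  classical
  ext ω
  unfold redundancy partialGenerator pairCount
  rw [Finset.card_filter, Nat.cast_sum, ← Finset.univ_product_univ, Finset.sum_product]
  refine Finset.sum_congr rfl fun p _ => Finset.sum_congr rfl fun q _ => ?_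
  simp only [pairFrequency, layerEigenvalue_val, delta, sub_eq_zero]
  split_ifs with h1 h2 h2
  · simp
  · exact absurd h1.symm h2
  · exact absurd h2.symm h1
  · simp

theorem redundancy_succ_self (l : ℕ) : M.redundancy (l + 1) l = delta := by
  have : IsEmpty (LayerRange L (l + 1) l) := ⟨fun k => by have := k.2; omega⟩
  rw [redundancy_eq_pairCount, pairCount_of_isEmpty]

/-- The layers `h, …, l + 1` are the layers `h, …, l` together with one more. -/
def layerRangeSuccEquiv {h l : ℕ} (hh : h ≤ l + 1) (hl : l < L) :
    Option (LayerRange L h l) ≃ LayerRange L h (l + 1) where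
  toFun o := o.elim ⟨⟨l, hl⟩, hh, le_rfl⟩ fun k => ⟨k.1, k.2.1, k.2.2.trans (Nat.le_succ l)⟩
  invFun k := if hk : (k.1 : ℕ) + 1 ≤ l then some ⟨k.1, k.2.1, hk⟩ else none
  left_inv o := by
    cases o with
    | none => simp
    | some k => simp [k.2.2]
  right_inv k := by
    by_cases hk : (k.1 : ℕ) + 1 ≤ l
    · simp [hk]
    · have : (k.1 : ℕ) = l := by have := k.2; omega
      simp only [hk, dif_neg, not_false_iff, Option.elim]
      exact Subtype.ext (Fin.ext this.symm)

/-- Adding a layer at the top convolves the counts with the differences of that layer. With the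
value `delta` for an empty range, this determines all the redundancies used below. -/
theorem redundancy_succ {h l : ℕ} (hh : h ≤ l + 1) (hl : l < L) :
    M.redundancy h (l + 1) = differenceConv (M.layerEigenvalue l) (M.redundancy h l) := by
  rw [redundancy_eq_pairCount, redundancy_eq_pairCount]
  ext ω
  rw [← pairCount_congr (layerRangeSuccEquiv hh hl), pairCount_option]
  rfl

theorem redundancy_self {l : ℕ} (hl : l < L) :
    M.redundancy (l + 1) (l + 1) = differenceConv (M.layerEigenvalue l) delta := by
  rw [M.redundancy_succ le_rfl hl, redundancy_succ_self]

theorem redundancy_one {m : ℕ} (hm : m ≤ L) :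
    M.redundancy 1 m = pathCount M.layerEigenvalue m := by
  induction m with
  | zero => exact M.redundancy_succ_self 0
  | succ m ih => rw [M.redundancy_succ (by omega) hm, ih (by omega), pathCount]

theorem mem_partialSpectrum {h l : ℕ} {ω : ℝ} :
    ω ∈ M.partialSpectrum h l ↔ M.redundancy h l ω ≠ 0 := by
  classical
  simp [partialSpectrum, redundancy, partialGenerator, Finset.filter_eq_empty_iff]

theorem mem_spectrum {ω : ℝ} : ω ∈ M.spectrum ↔ pathCount M.layerEigenvalue L ω ≠ 0 := by
  rw [spectrum, mem_partialSpectrum, M.redundancy_one le_rfl]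

/-- Summing over distinct differences weighted by multiplicity is the same as summing over all pairs
of eigenvalues. -/
theorem sum_redundancy_mul {l : ℕ} (hl : l < L) (g : ℝ → ℝ) (ω : ℝ) :
    ∑ k ∈ M.partialSpectrum (l + 1) (l + 1), M.redundancy (l + 1) (l + 1) k * g (ω - k) =
      differenceConv (M.layerEigenvalue l) g ω := by
  have hmem : ∀ j j', M.layerEigenvalue l j - M.layerEigenvalue l j' ∈
      M.partialSpectrum (l + 1) (l + 1) := by
    intro j j'
    rw [mem_partialSpectrum, M.redundancy_self hl]
    intro h0
    have := eq_zero_of_differenceConv_eq_zero delta_nonneg h0 j j'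
    rw [sub_self, delta_zero] at this
    exact one_ne_zero this
  simp only [M.redundancy_self hl, differenceConv_apply, Finset.sum_mul]
  rw [Finset.sum_comm]
  refine Finset.sum_congr rfl fun j _ => ?_
  rw [Finset.sum_comm]
  refine Finset.sum_congr rfl fun j' _ => ?_
  rw [Finset.sum_eq_single_of_mem _ (hmem j j')]
  · rw [sub_self, delta_zero, one_mul]
  · intro k _ hk
    rw [delta_of_ne_zero (sub_ne_zero.2 hk), zero_mul]

theorem zero_mem_partialSpectrum {l : ℕ} (hl : l < L) : 0 ∈ M.partialSpectrum (l + 1) (l + 1) := by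
  rw [mem_partialSpectrum, M.redundancy_self hl]
  intro h0
  have := eq_zero_of_differenceConv_eq_zero delta_nonneg h0 0 0
  rw [sub_self, sub_self, delta_zero] at this
  exact one_ne_zero this

theorem sum_delta_mul {l : ℕ} (hl : l < L) (g : ℝ → ℝ) (ω : ℝ) :
    ∑ k ∈ M.partialSpectrum (l + 1) (l + 1), delta k * g (ω - k) = g ω := by
  rw [Finset.sum_eq_single_of_mem _ (M.zero_mem_partialSpectrum hl)]
  · rw [delta_zero, sub_zero, one_mul]
  · intro k _ hk
    rw [delta_of_ne_zero hk, zero_mul]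

/-! ### Solving the exact and approximate layer recursions -/

theorem dim_eq : M.dim = ((2 ^ n : ℕ) : ℝ) := by simp [dim]

variable (hn : 1 ≤ n)
include hn

theorem two_le_two_pow : 2 ≤ 2 ^ n := by
  simpa using Nat.pow_le_pow_right (n := 2) (by norm_num) hn

/-- The offset `δ/d` is the share of the trace. Substituting it cancels the inhomogeneous terms of
the recursion, since `D δ` is the redundancy of the new layer. -/
theorem layerRecursion_exactWeight {m : ℕ} (hm : m < L) :
    M.layerRecursion M.exactWeight m =
      varianceProfile M.layerEigenvalue (m + 1) + (1 / M.dim) • delta := by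
  have hq := sub_pos.2 (one_lt_cast_sq (two_le_two_pow hn))
  have hd : (2 : ℝ) ≤ M.dim := by rw [dim_eq]; exact_mod_cast two_le_two_pow hn
  rw [← M.dim_eq] at hq
  induction m with
  | zero =>
    ext ω
    simp only [layerRecursion, varianceProfile, M.redundancy_self hm, ← M.dim_eq, map_smul,
      Pi.add_apply, Pi.smul_apply, Pi.sub_apply, smul_eq_mul]
    have : M.dim ^ 2 - 1 = (M.dim + 1) * (M.dim - 1) := by ring
    have h1 : 0 < M.dim - 1 := by linarith
    rw [this]
    field_simp
    ring
  | succ m ih =>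
    ext ω
    have ih := ih (by omega)
    have hsum : ∑ k ∈ M.partialSpectrum (m + 2) (m + 2),
        M.exactWeight (m + 2) k * M.layerRecursion M.exactWeight m (ω - k) =
        (differenceConv (M.layerEigenvalue (m + 1)) (M.layerRecursion M.exactWeight m) ω -
          M.layerRecursion M.exactWeight m ω) / (M.dim ^ 2 - 1) := by
      rw [← M.sum_redundancy_mul hm, ← M.sum_delta_mul hm (M.layerRecursion M.exactWeight m),
        ← Finset.sum_sub_distrib, Finset.sum_div]
      exact Finset.sum_congr rfl fun k _ => by rw [exactWeight]; ring
    rw [layerRecursion, hsum, ih, M.redundancy_self hm, varianceProfile.eq_def _ (m + 2)]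
    simp only [← M.dim_eq, map_smul, map_add,
      Pi.add_apply, Pi.smul_apply, Pi.sub_apply, smul_eq_mul]
    field_simp
    ring

/-- Without the subtracted term the offset `δ/d` cancels only up to `δ/(d(d²-1))`, which is the
source term of `approxProfile`. -/
theorem layerRecursion_approxWeight {m : ℕ} (hm : m < L) :
    M.layerRecursion M.approxWeight m =
      approxProfile M.layerEigenvalue m + (1 / M.dim) • delta := by
  have hq := sub_pos.2 (one_lt_cast_sq (two_le_two_pow hn))
  have hd : (2 : ℝ) ≤ M.dim := by rw [dim_eq]; exact_mod_cast two_le_two_pow hn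
  rw [← M.dim_eq] at hq
  induction m with
  | zero =>
    rw [approxProfile, ← M.layerRecursion_exactWeight hn hm]
    rfl
  | succ m ih =>
    ext ω
    have ih := ih (by omega)
    have hsum : ∑ k ∈ M.partialSpectrum (m + 2) (m + 2),
        M.approxWeight (m + 2) k * M.layerRecursion M.approxWeight m (ω - k) =
        differenceConv (M.layerEigenvalue (m + 1)) (M.layerRecursion M.approxWeight m) ω /
          (M.dim ^ 2 - 1) := by
      rw [← M.sum_redundancy_mul hm, Finset.sum_div]
      exact Finset.sum_congr rfl fun k _ => by rw [approxWeight]; ring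
    rw [layerRecursion, hsum, ih, M.redundancy_self hm, approxProfile]
    simp only [← M.dim_eq, map_smul, map_add,
      Pi.add_apply, Pi.smul_apply, smul_eq_mul]
    field_simp
    ring

/-- The `j`-th summand is the source created at layer `j - 1` and propagated through the layers `j,
…, m + 1`. Sources arise only from layer `2` on, so `j` starts at `3`; the last source has not been
propagated and is the separate `delta` term. -/
theorem closedForm_eq_approxProfile {m : ℕ} (hm : m < L) :
    (1 / (M.dim * (M.dim + 1) * (M.dim ^ 2 - 1) ^ m)) •
        (M.redundancy 1 (m + 1) - M.redundancy 2 (m + 1)) +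
      ∑ j ∈ Finset.Icc 3 (m + 1),
        (1 / (M.dim * (M.dim ^ 2 - 1) ^ (m + 3 - j))) • M.redundancy j (m + 1) +
      (if 1 ≤ m then 1 / (M.dim * (M.dim ^ 2 - 1)) else 0) • delta =
    approxProfile M.layerEigenvalue m := by
  have hq := sub_pos.2 (one_lt_cast_sq (two_le_two_pow hn))
  have hd : (2 : ℝ) ≤ M.dim := by rw [dim_eq]; exact_mod_cast two_le_two_pow hn
  rw [← M.dim_eq] at hq
  induction m with
  | zero =>
    ext ω
    simp only [approxProfile, varianceProfile, M.redundancy_self hm, M.redundancy_succ_self 1,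
      ← M.dim_eq, map_smul, zero_add]
    simp only [Pi.add_apply, Pi.smul_apply, Pi.sub_apply, smul_eq_mul]
    have : M.dim ^ 2 - 1 = (M.dim + 1) * (M.dim - 1) := by ring
    have h1 : 0 < M.dim - 1 := by linarith
    simp [this]
    field_simp
  | succ m ih =>
    rw [approxProfile, ← ih (by omega)]
    simp only [map_add, map_smul, map_sub, map_sum, ← M.dim_eq]
    rw [← M.redundancy_succ (h := 1) (by omega) hm, ← M.redundancy_succ (h := 2) (by omega) hm,
      ← M.redundancy_self hm]
    have hsum : ∑ j ∈ Finset.Icc 3 (m + 1),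
        (1 / (M.dim * (M.dim ^ 2 - 1) ^ (m + 3 - j))) •
          differenceConv (M.layerEigenvalue (m + 1)) (M.redundancy j (m + 1)) =
        (M.dim ^ 2 - 1) • ∑ j ∈ Finset.Icc 3 (m + 1),
        (1 / (M.dim * (M.dim ^ 2 - 1) ^ (m + 1 + 3 - j))) • M.redundancy j (m + 2) := by
      rw [Finset.smul_sum]
      refine Finset.sum_congr rfl fun j hj => ?_
      have hj := (Finset.mem_Icc.1 hj).2
      rw [← M.redundancy_succ (by omega) hm, smul_smul,
        show m + 1 + 3 - j = m + 3 - j + 1 by omega, pow_succ]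
      congr 1
      field_simp
      ring
    rw [hsum]
    -- With one layer there is no source yet to propagate. Otherwise the previous `delta` term is
    -- turned by `D` into the new top summand `j = m + 2`.
    rcases m.eq_zero_or_pos with rfl | hm0
    · ext ω
      simp
      field_simp
    · rw [Finset.sum_Icc_succ_top (by omega : 3 ≤ m + 1 + 1),
        show m + 1 + 3 - (m + 1 + 1) = 2 by omega, if_pos (show 1 ≤ m from hm0),
        if_pos (show 1 ≤ m + 1 by omega)]
      ext ω
      simp only [Pi.add_apply, Pi.smul_apply, Pi.sub_apply, smul_eq_mul]
      rw [pow_succ]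
      field_simp
      ring

theorem approxVariance_eq (hL : 1 ≤ L) (ω : ℝ) :
    M.approxVariance ω = M.coeffTwo * approxProfile M.layerEigenvalue (L - 1) ω := by
  rw [approxVariance, ← M.closedForm_eq_approxProfile hn (by omega : L - 1 < L)]
  obtain ⟨m, rfl⟩ : ∃ m, L = m + 1 := ⟨L - 1, by omega⟩
  simp only [Pi.add_apply, Pi.smul_apply, Pi.sub_apply, smul_eq_mul, Finset.sum_apply,
    Nat.add_sub_cancel, one_div_mul_eq_div, show 2 ≤ m + 1 ↔ 1 ≤ m by omega]
  congr 2
  split_ifs <;> ring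

end Redundancy

end ReuploadingModel

/-! ### Products over layers and sums over paths -/

section LayerProducts

variable {d : ℕ}

theorem prod_reverse_ofFn_succ {R : Type*} [Monoid R] {m : ℕ} (T : Fin (m + 1) → R) :
    (List.ofFn T).reverse.prod =
      T (Fin.last m) * (List.ofFn fun i : Fin m => T i.castSucc).reverse.prod := by
  rw [List.ofFn_succ']
  simp

theorem sum_eq_sum_snoc {A : Type*} [AddCommMonoid A] {m : ℕ} (F : (Fin (m + 1) → Fin d) → A) :
    ∑ J, F J = ∑ j : Fin d, ∑ J : Fin m → Fin d, F (Fin.snoc (α := fun _ => Fin d) J j) := by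
  rw [← Fintype.sum_prod_type']
  exact (Fintype.sum_equiv (Fin.snocEquiv fun _ => Fin d) _ _ fun p => rfl).symm

theorem prod_reverse_ofFn_sum {R : Type*} [Semiring R] {m : ℕ} (A : Fin m → Fin d → R) :
    (List.ofFn fun l => ∑ j, A l j).reverse.prod =
      ∑ J : Fin m → Fin d, (List.ofFn fun l => A l (J l)).reverse.prod := by
  induction m with
  | zero => simp
  | succ m ih =>
    rw [prod_reverse_ofFn_succ, ih, sum_eq_sum_snoc, Finset.sum_mul_sum]
    refine Finset.sum_congr rfl fun j _ => Finset.sum_congr rfl fun J _ => ?_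
    rw [prod_reverse_ofFn_succ]
    simp

theorem prod_reverse_ofFn_smul {R : Type*} [Semiring R] [Algebra ℂ R] {m : ℕ} (c : Fin m → ℂ)
    (T : Fin m → R) :
    (List.ofFn fun l => c l • T l).reverse.prod = (∏ l, c l) • (List.ofFn T).reverse.prod := by
  induction m with
  | zero => simp
  | succ m ih =>
    rw [prod_reverse_ofFn_succ, ih, prod_reverse_ofFn_succ T, Fin.prod_univ_castSucc,
      smul_mul_smul_comm, mul_comm (c (Fin.last m))]

/-- The operator `|v_j⟩⟨v_k|` built from the columns of a matrix. -/
def ketBra (V : Matrix (Fin d) (Fin d) ℂ) (j k : Fin d) : Matrix (Fin d) (Fin d) ℂ :=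
  Matrix.of fun a b => V a j * star (V b k)

theorem ketBra_conjTranspose (V : Matrix (Fin d) (Fin d) ℂ) (j k : Fin d) :
    (ketBra V j k).conjTranspose = ketBra V k j := by
  ext a b
  simp [ketBra, mul_comm]

theorem ketBra_mul_mul_ketBra (V A : Matrix (Fin d) (Fin d) ℂ) (j k l m : Fin d) :
    ketBra V j k * A * ketBra V l m = (ketBra V l k * A).trace • ketBra V j m := by
  ext a b
  simp only [ketBra, Matrix.mul_apply, Matrix.of_apply, Matrix.trace, Matrix.diag_apply,
    Matrix.smul_apply, smul_eq_mul, Finset.sum_mul]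
  exact Finset.sum_congr rfl fun x _ => Finset.sum_congr rfl fun y _ => by ring

theorem trace_ketBra {V : Matrix (Fin d) (Fin d) ℂ} (hV : V ∈ Matrix.unitaryGroup (Fin d) ℂ)
    (j k : Fin d) : (ketBra V j k).trace = if j = k then 1 else 0 := by
  have h := congrFun (congrFun (Matrix.mem_unitaryGroup_iff'.1 hV) k) j
  rw [Matrix.one_apply, Matrix.mul_apply] at h
  simp only [eq_comm (a := j)]
  rw [← h]
  simp [ketBra, Matrix.trace, mul_comm]

theorem ketBra_mul_ketBra {V : Matrix (Fin d) (Fin d) ℂ} (hV : V ∈ Matrix.unitaryGroup (Fin d) ℂ)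
    (j k l m : Fin d) : ketBra V j k * ketBra V l m = if k = l then ketBra V j m else 0 := by
  have h := ketBra_mul_mul_ketBra V 1 j k l m
  rw [Matrix.mul_one, Matrix.mul_one, trace_ketBra hV] at h
  rw [h]
  simp [eq_comm (a := k)]

theorem sum_ketBra {V : Matrix (Fin d) (Fin d) ℂ} (hV : V ∈ Matrix.unitaryGroup (Fin d) ℂ) :
    ∑ j, ketBra V j j = 1 := by
  rw [← Matrix.mem_unitaryGroup_iff.1 hV]
  ext a b
  simp [ketBra, Matrix.sum_apply, Matrix.mul_apply]

theorem trace_sum_ketBra_mul_conjTranspose {V : Matrix (Fin d) (Fin d) ℂ}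
    (hV : V ∈ Matrix.unitaryGroup (Fin d) ℂ) (c : Fin d → Fin d → ℂ) :
    ((∑ j, ∑ j', c j j' • ketBra V j' j) *
      (∑ j, ∑ j', c j j' • ketBra V j' j).conjTranspose).trace =
      ∑ j, ∑ j', c j j' * star (c j j') := by
  simp only [Matrix.conjTranspose_sum, Matrix.conjTranspose_smul, ketBra_conjTranspose,
    Finset.sum_mul, Finset.mul_sum, Matrix.trace_sum, smul_mul_smul_comm, ketBra_mul_ketBra hV,
    Matrix.trace_smul, apply_ite Matrix.trace, Matrix.trace_zero, trace_ketBra hV, smul_eq_mul]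
  refine Finset.sum_congr rfl fun j _ => Finset.sum_congr rfl fun j' _ => ?_
  rw [Finset.sum_eq_single_of_mem j (Finset.mem_univ j) fun k _ hk => ?_]
  · simp
  · simp [hk]

/-- The component of frequency `ω` of the initial operator `s` propagated through the first `m`
layers. -/
noncomputable def frequencyComponent (V : ℕ → Matrix (Fin d) (Fin d) ℂ) (x : ℕ → Fin d → ℝ)
    (s : Matrix (Fin d) (Fin d) ℂ) (w : ℕ → Matrix (Fin d) (Fin d) ℂ) :
    ℕ → ℝ → Matrix (Fin d) (Fin d) ℂ
  | 0, ω => (ReuploadingModel.delta ω : ℂ) • s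
  | m + 1, ω => ∑ j, ∑ j', ketBra (V m) j' j' *
      (w m * frequencyComponent V x s w m (ω - (x m j - x m j')) * (w m).conjTranspose) *
      ketBra (V m) j j

variable (V : ℕ → Matrix (Fin d) (Fin d) ℂ) (x : ℕ → Fin d → ℝ) (s : Matrix (Fin d) (Fin d) ℂ)

/-- The component after `m` layers sees only the first `m` unitaries. This makes it a function on a
finite product of compact groups, independent of the next layer. -/
theorem frequencyComponent_congr {w w' : ℕ → Matrix (Fin d) (Fin d) ℂ} {m : ℕ}
    (h : ∀ i < m, w i = w' i) :
    frequencyComponent V x s w m = frequencyComponent V x s w' m := by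
  induction m with
  | zero => rfl
  | succ m ih =>
    ext1 ω
    simp only [frequencyComponent, ih fun i hi => h i (hi.trans (Nat.lt_succ_self m)),
      h m (Nat.lt_succ_self m)]

theorem continuous_frequencyComponent {X : Type*} [TopologicalSpace X]
    {w : X → ℕ → Matrix (Fin d) (Fin d) ℂ} (hw : ∀ i, Continuous fun t => w t i) (m : ℕ) :
    ∀ ω, Continuous fun t => frequencyComponent V x s (w t) m ω := by
  induction m with
  | zero => exact fun ω => continuous_const
  | succ m ih =>
    intro ω
    simp only [frequencyComponent]
    exact continuous_finsetSum _ fun j _ => continuous_finsetSum _ fun j' _ =>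
      (continuous_const.matrix_mul (((hw m).matrix_mul (ih _)).matrix_mul
        (hw m).matrix_conjTranspose)).matrix_mul continuous_const

theorem frequencyComponent_eq_sum (w : ℕ → Matrix (Fin d) (Fin d) ℂ) (m : ℕ) :
    ∀ ω, frequencyComponent V x s w m ω = ∑ J : Fin m → Fin d, ∑ J' : Fin m → Fin d,
      (ReuploadingModel.delta (ω - ∑ l : Fin m, (x l (J l) - x l (J' l))) : ℂ) •
        ((List.ofFn fun l : Fin m => ketBra (V l) (J' l) (J' l) * w l).reverse.prod * s *
        (List.ofFn fun l : Fin m => ketBra (V l) (J l) (J l) * w l).reverse.prod.conjTranspose) := by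
  induction m with
  | zero => intro ω; simp [frequencyComponent]
  | succ m ih =>
    intro ω
    simp only [frequencyComponent, ih]
    rw [sum_eq_sum_snoc]
    simp only [sum_eq_sum_snoc (fun J' : Fin (m + 1) → Fin d => _)]
    refine Finset.sum_congr rfl fun j _ => ?_
    rw [Finset.sum_comm]
    refine Finset.sum_congr rfl fun j' _ => ?_
    simp only [Finset.mul_sum, Finset.sum_mul]
    refine Finset.sum_congr rfl fun J _ => Finset.sum_congr rfl fun J' _ => ?_
    simp only [prod_reverse_ofFn_succ (fun l : Fin (m + 1) => _), Fin.sum_univ_castSucc,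
      Fin.snoc_castSucc, Fin.snoc_last, Fin.val_last, Fin.val_castSucc,
      Matrix.conjTranspose_mul, ketBra_conjTranspose]
    rw [← sub_sub, sub_right_comm]
    simp only [Matrix.mul_smul, Matrix.smul_mul, Matrix.mul_assoc]

variable {V}

/-- Only the blocks `j = j'` contribute to the trace; they do not shift the frequency, and their
projectors sum to `1`. The trace is thus deterministic, which closes the second moment recursion. -/
theorem trace_frequencyComponent (hV : ∀ m, V m ∈ Matrix.unitaryGroup (Fin d) ℂ)
    (w : ℕ → Matrix.unitaryGroup (Fin d) ℂ) (m : ℕ) :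
    ∀ ω, (frequencyComponent V x s (fun i => w i) m ω).trace =
      ReuploadingModel.delta ω * s.trace := by
  induction m with
  | zero => intro ω; simp [frequencyComponent]
  | succ m ih =>
    intro ω
    simp only [frequencyComponent, Matrix.trace_sum, ketBra_mul_mul_ketBra, Matrix.trace_smul,
      trace_ketBra (hV m), smul_eq_mul, mul_ite, mul_one, mul_zero, Finset.sum_ite_eq',
      Finset.mem_univ, if_true, sub_self, sub_zero]
    rw [← Matrix.trace_sum, ← Finset.sum_mul, sum_ketBra (hV m), Matrix.one_mul, trace_sandwich, ih]

/-- The operators `|v_{j'}⟩⟨v_j|` are orthonormal, so the squared norm is the sum of the squared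
matrix elements. Each of these is an overlap to which the 2-design formula for `w m` applies. -/
theorem trace_frequencyComponent_mul_conjTranspose
    (hV : ∀ m, V m ∈ Matrix.unitaryGroup (Fin d) ℂ) (w : ℕ → Matrix (Fin d) (Fin d) ℂ) (m : ℕ)
    (ω : ℝ) :
    (frequencyComponent V x s w (m + 1) ω *
      (frequencyComponent V x s w (m + 1) ω).conjTranspose).trace =
      ∑ j, ∑ j', (ketBra (V m) j j' * (w m *
        frequencyComponent V x s w m (ω - (x m j - x m j')) * (w m).conjTranspose)).trace *
        star (ketBra (V m) j j' * (w m *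
        frequencyComponent V x s w m (ω - (x m j - x m j')) * (w m).conjTranspose)).trace := by
  simp only [frequencyComponent, ketBra_mul_mul_ketBra]
  exact trace_sum_ketBra_mul_conjTranspose (hV m) _

end LayerProducts

/-! ### Second moments through independent layers -/

section Independence

variable {Θ : Type*} [MeasurableSpace Θ] {μ : Measure Θ} [IsProbabilityMeasure μ]

/-- Fubini for the joint law: the new layer can be averaged with the earlier layers frozen. -/
theorem ProbabilityTheory.IndepFun.integral_continuous {α β : Type*} [TopologicalSpace α]
    [CompactSpace α] [SecondCountableTopology α] [MeasurableSpace α] [BorelSpace α]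
    [TopologicalSpace β] [CompactSpace β] [SecondCountableTopology β] [MeasurableSpace β]
    [BorelSpace β] {X : Θ → α} {Y : Θ → β} (hX : Measurable X) (hY : Measurable Y)
    (hXY : ProbabilityTheory.IndepFun X Y μ) {g : α × β → ℂ} (hg : Continuous g) :
    ∫ θ, g (X θ, Y θ) ∂μ = ∫ θ, ∫ η, g (X θ, Y η) ∂μ ∂μ := by
  have : IsProbabilityMeasure (μ.map X) := Measure.isProbabilityMeasure_map hX.aemeasurable
  have : IsProbabilityMeasure (μ.map Y) := Measure.isProbabilityMeasure_map hY.aemeasurable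
  have hmap := (ProbabilityTheory.indepFun_iff_map_prod_eq_prod_map_map hX.aemeasurable
    hY.aemeasurable).1 hXY
  have hgm : Measurable g := hg.measurable
  calc ∫ θ, g (X θ, Y θ) ∂μ = ∫ p, g p ∂(μ.map fun θ => (X θ, Y θ)) :=
        (integral_map (hX.prodMk hY).aemeasurable hgm.aestronglyMeasurable).symm
    _ = ∫ a, ∫ b, g (a, b) ∂(μ.map Y) ∂(μ.map X) := by
        rw [hmap]
        exact integral_prod g (Continuous.integrable_comp_of_compactSpace hg measurable_id)
    _ = ∫ θ, ∫ b, g (X θ, b) ∂(μ.map Y) ∂μ :=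
        integral_map hX.aemeasurable
          (hgm.stronglyMeasurable.integral_prod_right'
            (f := g) (ν := μ.map Y)).aestronglyMeasurable
    _ = ∫ θ, ∫ η, g (X θ, Y η) ∂μ ∂μ := by
        congr 1 with θ
        exact integral_map hY.aemeasurable
          (hgm.comp measurable_prodMk_left).aestronglyMeasurable

variable {d : ℕ}

/-- Extension of a finite tuple of unitaries by the identity. -/
noncomputable def extendByOne {m : ℕ} (t : Fin m → Matrix.unitaryGroup (Fin d) ℂ) (i : ℕ) :
    Matrix (Fin d) (Fin d) ℂ :=
  if h : i < m then (t ⟨i, h⟩ : Matrix (Fin d) (Fin d) ℂ) else 1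

theorem continuous_extendByOne {m : ℕ} (i : ℕ) :
    Continuous fun t : Fin m → Matrix.unitaryGroup (Fin d) ℂ => extendByOne t i := by
  by_cases h : i < m
  · simp only [extendByOne, h, dif_pos]
    exact continuous_subtype_val.comp (continuous_apply (⟨i, h⟩ : Fin m))
  · simp only [extendByOne, h, dif_neg, not_false_iff]
    exact continuous_const

variable {V : ℕ → Matrix (Fin d) (Fin d) ℂ} (x : ℕ → Fin d → ℝ) (s : Matrix (Fin d) (Fin d) ℂ)
  {W : ℕ → Θ → Matrix.unitaryGroup (Fin d) ℂ}

theorem measurable_initial (hW : ∀ m, Measurable (W m)) (m : ℕ) :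
    Measurable fun θ => fun i : Fin m => W i θ :=
  measurable_pi_lambda _ fun i => hW i

theorem frequencyComponent_extendByOne (w : ℕ → Matrix.unitaryGroup (Fin d) ℂ) (m : ℕ) (ω : ℝ) :
    frequencyComponent V x s (extendByOne fun i : Fin m => w i) m ω =
      frequencyComponent V x s (fun i => w i) m ω := by
  rw [frequencyComponent_congr V x s fun i hi => ?_]
  simp [extendByOne, hi]

theorem continuous_overlap (Q : Matrix (Fin d) (Fin d) ℂ) (m : ℕ) (ω : ℝ) :
    Continuous fun p : (Fin m → Matrix.unitaryGroup (Fin d) ℂ) × Matrix.unitaryGroup (Fin d) ℂ =>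
      (Q * ((p.2 : Matrix (Fin d) (Fin d) ℂ) * frequencyComponent V x s (extendByOne p.1) m ω *
        (p.2 : Matrix (Fin d) (Fin d) ℂ).conjTranspose)).trace := by
  have h1 : Continuous fun p : (Fin m → Matrix.unitaryGroup (Fin d) ℂ) ×
      Matrix.unitaryGroup (Fin d) ℂ => (p.2 : Matrix (Fin d) (Fin d) ℂ) :=
    continuous_subtype_val.comp continuous_snd
  have h2 : Continuous fun p : (Fin m → Matrix.unitaryGroup (Fin d) ℂ) ×
      Matrix.unitaryGroup (Fin d) ℂ => frequencyComponent V x s (extendByOne p.1) m ω :=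
    continuous_frequencyComponent V x s (fun i => (continuous_extendByOne i).comp continuous_fst)
      m ω
  exact (continuous_const.matrix_mul ((h1.matrix_mul h2).matrix_mul
    h1.matrix_conjTranspose)).matrix_trace

theorem memLp_overlap (hW : ∀ m, Measurable (W m)) (Q : Matrix (Fin d) (Fin d) ℂ) (m : ℕ) (ω : ℝ)
    (p : ENNReal) :
    MemLp (fun θ => (Q * ((W m θ : Matrix (Fin d) (Fin d) ℂ) *
      frequencyComponent V x s (fun i => W i θ) m ω *
        (W m θ : Matrix (Fin d) (Fin d) ℂ).conjTranspose)).trace) p μ := by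
  have h := Continuous.memLp_comp_of_compactSpace (μ := μ) (continuous_overlap x s (V := V) Q m ω)
    (W := fun θ => (fun i : Fin m => W i θ, W m θ))
    ((measurable_initial hW m).prodMk (hW m)) p
  simpa only [fun θ => frequencyComponent_extendByOne x s (V := V) (fun i => W i θ)] using h

theorem integrable_trace_mul_conjTranspose (hW : ∀ m, Measurable (W m)) (m : ℕ) (ω : ℝ) :
    Integrable (fun θ => (frequencyComponent V x s (fun i => W i θ) m ω *
      (frequencyComponent V x s (fun i => W i θ) m ω).conjTranspose).trace) μ := by
  have hc : Continuous fun t : Fin m → Matrix.unitaryGroup (Fin d) ℂ =>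
      frequencyComponent V x s (extendByOne t) m ω :=
    continuous_frequencyComponent V x s (fun i => continuous_extendByOne i) m ω
  have h := Continuous.integrable_comp_of_compactSpace (μ := μ)
    (hc.matrix_mul hc.matrix_conjTranspose).matrix_trace
    (W := fun θ => fun i : Fin m => W i θ) (measurable_initial hW m)
  simpa only [fun θ => frequencyComponent_extendByOne x s (V := V) (fun i => W i θ)] using h

theorem integral_overlap (hV : ∀ m, V m ∈ Matrix.unitaryGroup (Fin d) ℂ)
    (hW : ∀ m, Measurable (W m)) {m : ℕ} (hdes : IsTwoDesign μ (W m)) (hd : 2 ≤ d)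
    (hind : ProbabilityTheory.IndepFun (fun θ (i : Fin m) => W i θ) (W m) μ)
    (Q : Matrix (Fin d) (Fin d) ℂ) (ω : ℝ) :
    ∫ θ, (Q * ((W m θ : Matrix (Fin d) (Fin d) ℂ) *
      frequencyComponent V x s (fun i => W i θ) m ω *
        (W m θ : Matrix (Fin d) (Fin d) ℂ).conjTranspose)).trace ∂μ =
      ReuploadingModel.delta ω * s.trace * Q.trace / d := by
  have h := hind.integral_continuous (measurable_initial hW m) (hW m)
    (continuous_overlap x s (V := V) Q m ω)
  simp only [fun θ => frequencyComponent_extendByOne x s (V := V) (fun i => W i θ)] at h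
  rw [h]
  simp only [hdes.integral_trace (hW m) hd, trace_frequencyComponent x s hV]
  simp

/-- Averaging the last unitary first leaves an expression affine in `Tr(ρ ρ†)`, because the trace of
`ρ` is the constant `δ`; only the expected squared norm remains to be integrated. -/
theorem integral_overlap_mul_star (hV : ∀ m, V m ∈ Matrix.unitaryGroup (Fin d) ℂ)
    (hW : ∀ m, Measurable (W m)) {m : ℕ} (hdes : IsTwoDesign μ (W m)) (hd : 2 ≤ d)
    (hind : ProbabilityTheory.IndepFun (fun θ (i : Fin m) => W i θ) (W m) μ)
    (Q : Matrix (Fin d) (Fin d) ℂ) (hs : s.trace = 1) (ω : ℝ) :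
    ∫ θ, (Q * ((W m θ : Matrix (Fin d) (Fin d) ℂ) *
      frequencyComponent V x s (fun i => W i θ) m ω *
        (W m θ : Matrix (Fin d) (Fin d) ℂ).conjTranspose)).trace *
      star (Q * ((W m θ : Matrix (Fin d) (Fin d) ℂ) *
      frequencyComponent V x s (fun i => W i θ) m ω *
        (W m θ : Matrix (Fin d) (Fin d) ℂ).conjTranspose)).trace ∂μ =
      (d * ReuploadingModel.delta ω - ∫ θ, (frequencyComponent V x s (fun i => W i θ) m ω *
        (frequencyComponent V x s (fun i => W i θ) m ω).conjTranspose).trace ∂μ) /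
        (d * (d ^ 2 - 1)) * (Q.trace * star Q.trace) +
      (d * (∫ θ, (frequencyComponent V x s (fun i => W i θ) m ω *
        (frequencyComponent V x s (fun i => W i θ) m ω).conjTranspose).trace ∂μ) -
        ReuploadingModel.delta ω) / (d * (d ^ 2 - 1)) * (Q * Q.conjTranspose).trace := by
  have hc := continuous_overlap x s (V := V) Q m ω
  have h := hind.integral_continuous (measurable_initial hW m) (hW m)
    (hc.mul hc.star)
  simp only [Pi.mul_apply,
    fun θ => frequencyComponent_extendByOne x s (V := V) (fun i => W i θ)] at h
  rw [h]
  have hdel : (ReuploadingModel.delta ω : ℂ) * star (ReuploadingModel.delta ω : ℂ) =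
      ReuploadingModel.delta ω := by
    by_cases h0 : ω = 0 <;> simp [ReuploadingModel.delta, h0]
  simp only [hdes.integral_trace_mul (hW m) hd, trace_frequencyComponent x s hV, hs, mul_one, hdel]
  have hint := integrable_trace_mul_conjTranspose (μ := μ) x s (V := V) hW m ω
  rw [integral_add, integral_mul_const, integral_mul_const, integral_div, integral_div,
    integral_sub (integrable_const _) hint, integral_sub (hint.const_mul _) (integrable_const _)]
  · simp only [integral_const_mul, integral_const, probReal_univ, one_smul]
  · exact (((integrable_const _).sub hint).div_const _).mul_const _
  · exact (((hint.const_mul _).sub (integrable_const _)).div_const _).mul_const _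

/-- `δ/d` is the squared norm of the multiple of the identity having the same trace as the
component, so `varianceProfile` is the expected squared norm of the traceless part. -/
theorem integral_trace_mul_conjTranspose (hV : ∀ m, V m ∈ Matrix.unitaryGroup (Fin d) ℂ)
    (hW : ∀ m, Measurable (W m)) {L : ℕ} (hdes : ∀ m < L, IsTwoDesign μ (W m)) (hd : 2 ≤ d)
    (hind : ∀ m < L, ProbabilityTheory.IndepFun (fun θ (i : Fin m) => W i θ) (W m) μ)
    (hs : s.trace = 1) (hs2 : (s * s.conjTranspose).trace = 1) {m : ℕ} (hm : m ≤ L) (ω : ℝ) :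
    ∫ θ, (frequencyComponent V x s (fun i => W i θ) m ω *
        (frequencyComponent V x s (fun i => W i θ) m ω).conjTranspose).trace ∂μ =
      ((ReuploadingModel.varianceProfile x m ω + ReuploadingModel.delta ω / d : ℝ) : ℂ) := by
  have hd0 : (d : ℂ) ≠ 0 := by exact_mod_cast (by omega : d ≠ 0)
  have hd1 := natCast_sq_sub_one_ne_zero hd
  induction m generalizing ω with
  | zero =>
    simp only [frequencyComponent, Matrix.conjTranspose_smul, smul_mul_smul_comm,
      Matrix.trace_smul, hs2, ReuploadingModel.varianceProfile]
    by_cases h0 : ω = 0 <;> simp [ReuploadingModel.delta, h0]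
  | succ m ih =>
    have hO : ∀ Q ω, Integrable (fun θ => (Q * ((W m θ : Matrix (Fin d) (Fin d) ℂ) *
      frequencyComponent V x s (fun i => W i θ) m ω *
        (W m θ : Matrix (Fin d) (Fin d) ℂ).conjTranspose)).trace *
      star (Q * ((W m θ : Matrix (Fin d) (Fin d) ℂ) *
      frequencyComponent V x s (fun i => W i θ) m ω *
        (W m θ : Matrix (Fin d) (Fin d) ℂ).conjTranspose)).trace) μ := fun Q ω => by
      have h := memLp_overlap (μ := μ) x s (V := V) hW Q m ω 2
      exact h.integrable_mul h.star
    simp only [trace_frequencyComponent_mul_conjTranspose x s hV]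
    rw [integral_finsetSum _ fun j _ => integrable_finsetSum _ fun j' _ => hO _ _]
    simp only [integral_finsetSum _ fun j' _ => hO _ _,
      integral_overlap_mul_star x s hV hW (hdes m (by omega)) hd (hind m (by omega)) _ hs,
      ih (by omega), trace_ketBra (hV m), ketBra_conjTranspose, ketBra_mul_ketBra (hV m), if_true]
    rw [ReuploadingModel.varianceProfile]
    simp only [Pi.smul_apply, Pi.sub_apply, smul_eq_mul, ReuploadingModel.differenceConv_apply]
    -- The operator `|v_j⟩⟨v_{j'}|` has norm one for all pairs but nonzero trace only for `j = j'`.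
    -- The diagonal pairs, which stay at frequency `ω`, therefore carry the extra term; summed over
    -- `j` it gives `-V/(d²-1)` and restores `δ/d`.
    have hterm : ∀ j j' : Fin d,
        (d * (ReuploadingModel.delta (ω - (x m j - x m j')) : ℂ) -
          ((ReuploadingModel.varianceProfile x m (ω - (x m j - x m j')) +
            ReuploadingModel.delta (ω - (x m j - x m j')) / d : ℝ) : ℂ)) / (d * (d ^ 2 - 1)) *
            ((if j = j' then 1 else 0) * star (if j = j' then 1 else 0)) +
        (d * ((ReuploadingModel.varianceProfile x m (ω - (x m j - x m j')) +
            ReuploadingModel.delta (ω - (x m j - x m j')) / d : ℝ) : ℂ) -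
          (ReuploadingModel.delta (ω - (x m j - x m j')) : ℂ)) / (d * (d ^ 2 - 1)) * 1 =
        1 / (d ^ 2 - 1) *
          (ReuploadingModel.varianceProfile x m (ω - (x m j - x m j')) : ℂ) +
        (if j = j' then (d * (ReuploadingModel.delta ω : ℂ) -
          (ReuploadingModel.varianceProfile x m ω : ℂ) - ReuploadingModel.delta ω / d) /
          (d * (d ^ 2 - 1)) else 0) := by
      intro j j'
      by_cases hj : j = j'
      · subst hj
        simp only [if_true, sub_self, sub_zero, star_one]
        push_cast
        field_simp
        ring
      · simp only [hj, if_false, star_zero]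
        push_cast
        field_simp
        ring
    simp only [hterm, Finset.sum_add_distrib, Finset.sum_ite_eq, Finset.mem_univ, if_true,
      Finset.sum_const, Finset.card_univ, Fintype.card_fin, nsmul_eq_mul, ← Finset.mul_sum]
    push_cast
    field_simp
    ring

end Independence

/-! ### Variance of complex random variables -/

theorem complexVariance_eq {Θ : Type*} [MeasurableSpace Θ] {μ : Measure Θ}
    [IsProbabilityMeasure μ] {X : Θ → ℂ} (hX : MemLp X 2 μ) :
    (complexVariance μ X : ℂ) =
      ∫ θ, X θ * star (X θ) ∂μ - (∫ θ, X θ ∂μ) * star (∫ θ, X θ ∂μ) := by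
  have h1 : Integrable X μ := hX.integrable (by norm_num)
  have h2 : Integrable (fun θ => X θ * star (X θ)) μ := hX.integrable_mul hX.star
  have h3 : Integrable (fun θ => star (X θ)) μ := hX.star.integrable (by norm_num)
  have hstar : ∫ θ, star (X θ) ∂μ = star (∫ θ, X θ ∂μ) := integral_conj
  unfold complexVariance
  rw [← integral_complex_ofReal]
  generalize hc : ∫ θ, X θ ∂μ = c at *
  have : ∀ θ, ((‖X θ - c‖ ^ 2 : ℝ) : ℂ) =
      X θ * star (X θ) - X θ * star c - (c * star (X θ) - c * star c) := by
    intro θ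
    have h := Complex.mul_conj' (X θ - c)
    push_cast
    rw [← h, map_sub]
    simp only [Complex.star_def]
    ring
  simp only [this]
  have i1 : Integrable (fun θ => X θ * star (X θ) - X θ * star c) μ := h2.sub (h1.mul_const _)
  have i2 : Integrable (fun θ => c * star (X θ) - c * star c) μ :=
    (h3.const_mul _).sub (integrable_const _)
  rw [integral_sub i1 i2, integral_sub h2 (h1.mul_const _), integral_sub (h3.const_mul _) (integrable_const _),
    integral_mul_const, integral_const_mul, hstar, hc]
  simp

namespace ReuploadingModel

variable {n L : ℕ} (M : ReuploadingModel n L)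

/-! ### The Fourier decomposition -/

/-- The unitary matrix of eigenvectors of the layers, indexed by natural numbers. -/
noncomputable def eigenMatrix (k : ℕ) : Matrix (Fin (2 ^ n)) (Fin (2 ^ n)) ℂ :=
  if h : k < L then ((M.hamiltonian_isHermitian ⟨k, h⟩).eigenvectorUnitary :
    Matrix (Fin (2 ^ n)) (Fin (2 ^ n)) ℂ) else 1

/-- The default value `1` keeps unitarity true at every index, as the layer lemmas require. -/
theorem eigenMatrix_mem (k : ℕ) : M.eigenMatrix k ∈ Matrix.unitaryGroup (Fin (2 ^ n)) ℂ := by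
  unfold eigenMatrix
  split_ifs with h
  · exact (M.hamiltonian_isHermitian ⟨k, h⟩).eigenvectorUnitary.2
  · exact one_mem _

theorem eigenMatrix_val (l : Fin L) :
    M.eigenMatrix l = (M.hamiltonian_isHermitian l).eigenvectorUnitary := by
  simp [eigenMatrix]

theorem eigenprojector_eq (l : Fin L) (j : Fin (2 ^ n)) :
    M.eigenprojector l j = ketBra (M.eigenMatrix l) j j := by
  ext a b
  simp [eigenprojector, ketBra, eigenMatrix_val, Matrix.IsHermitian.eigenvectorUnitary_apply]

theorem encoding_eq (l : Fin L) (x : ℝ) : M.encoding l x =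
    ∑ j, Complex.exp (-(Complex.I * x) * M.eigenvalue l j) • M.eigenprojector l j := by
  have hU : IsUnit (M.eigenMatrix l) :=
    (Unitary.toUnits ⟨_, M.eigenMatrix_mem l⟩).isUnit
  have hinv : (M.eigenMatrix l)⁻¹ = star (M.eigenMatrix l) :=
    Matrix.inv_eq_left_inv (Matrix.mem_unitaryGroup_iff'.1 (M.eigenMatrix_mem l))
  have hspec : (-(Complex.I * (x : ℂ))) • M.hamiltonian l = M.eigenMatrix l *
      Matrix.diagonal (fun j => -(Complex.I * x) * (M.eigenvalue l j : ℂ)) *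
        (M.eigenMatrix l)⁻¹ := by
    have h := (M.hamiltonian_isHermitian l).spectral_theorem
    rw [Unitary.conjStarAlgAut_apply, ← M.eigenMatrix_val] at h
    conv_lhs => rw [h]
    rw [hinv, ← Matrix.smul_mul, ← Matrix.mul_smul, ← Matrix.diagonal_smul]
    rfl
  rw [encoding, hspec, Matrix.exp_conj _ _ hU, Matrix.exp_diagonal, hinv]
  ext a b
  simp only [Matrix.sum_apply, Matrix.smul_apply, eigenprojector_eq, ketBra, Matrix.of_apply,
    smul_eq_mul, Matrix.mul_apply (N := star _), Matrix.mul_diagonal, Matrix.star_apply]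
  refine Finset.sum_congr rfl fun j _ => ?_
  rw [Pi.coe_exp, ← Complex.exp_eq_exp_ℂ]
  ring

theorem circuit_eq (W : Fin (L + 1) → Matrix.unitaryGroup (Fin (2 ^ n)) ℂ) (x : ℝ) :
    M.circuit W x = ∑ J : Fin L → Fin (2 ^ n),
      Complex.exp (-(Complex.I * x) * (∑ l, M.eigenvalue l (J l) : ℝ)) • M.pathOperator W J := by
  unfold circuit pathOperator
  simp only [encoding_eq, Finset.sum_mul, Matrix.smul_mul]
  rw [prod_reverse_ofFn_sum, Finset.mul_sum]
  refine Finset.sum_congr rfl fun J _ => ?_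
  rw [prod_reverse_ofFn_smul, ← Complex.exp_sum, Matrix.mul_smul]
  push_cast
  rw [Finset.mul_sum]

theorem model_eq_sum (W : Fin (L + 1) → Matrix.unitaryGroup (Fin (2 ^ n)) ℂ) (x : ℝ) :
    M.model W x = ∑ J : Fin L → Fin (2 ^ n), ∑ J' : Fin L → Fin (2 ^ n),
      ((M.pathOperator W J).conjTranspose * M.observable * M.pathOperator W J') 0 0 *
        Complex.exp (Complex.I * (∑ l, (M.eigenvalue l (J l) - M.eigenvalue l (J' l)) : ℝ) * x) := by
  unfold model
  rw [circuit_eq, Matrix.conjTranspose_sum]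
  simp only [Finset.sum_mul, Finset.mul_sum, Matrix.sum_apply, Matrix.conjTranspose_smul,
    Matrix.smul_mul, Matrix.mul_smul, Matrix.smul_apply, smul_eq_mul]
  rw [Finset.sum_comm]
  refine Finset.sum_congr rfl fun J _ => Finset.sum_congr rfl fun J' _ => ?_
  -- Conjugation reverses the phase of the path `J` in `U†`, so the combined exponent is `+i(Λ_J -
  -- Λ_{J'})x`.
  rw [Complex.star_def, ← Complex.exp_conj, ← mul_assoc, ← Complex.exp_add, mul_comm]
  congr 2
  simp only [map_mul, map_neg, Complex.conj_I, Complex.conj_ofReal]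
  rw [Finset.sum_sub_distrib]
  push_cast
  ring

theorem frequency_mem_spectrum (J J' : Fin L → Fin (2 ^ n)) :
    ∑ l, (M.eigenvalue l (J l) - M.eigenvalue l (J' l)) ∈ M.spectrum := by
  classical
  unfold spectrum partialSpectrum
  rw [Finset.mem_image]
  refine ⟨(fun k => J k.1, fun k => J' k.1), Finset.mem_univ _, ?_⟩
  exact Fintype.sum_equiv (Equiv.subtypeUnivEquiv fun k : Fin L =>
    ⟨Nat.le_add_left 1 _, k.2⟩) _ _ fun k => rfl

theorem model_eq_fourier (W : Fin (L + 1) → Matrix.unitaryGroup (Fin (2 ^ n)) ℂ) (x : ℝ) :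
    M.model W x = ∑ ω ∈ M.spectrum, M.fourierCoeff W ω *
      Complex.exp (Complex.I * (ω : ℂ) * (x : ℂ)) := by
  classical
  rw [model_eq_sum, ← Fintype.sum_prod_type']
  simp only [fourierCoeff, Finset.sum_mul]
  rw [Finset.sum_comm]
  refine Finset.sum_congr rfl fun p _ => ?_
  rw [Finset.sum_eq_single_of_mem _ (M.frequency_mem_spectrum p.1 p.2)]
  · rw [if_pos rfl]
  · intro ω _ h
    rw [if_neg h.symm, zero_mul]

/-- The projector onto the initial state. -/
noncomputable def initialState (n : ℕ) : Matrix (Fin (2 ^ n)) (Fin (2 ^ n)) ℂ :=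
  Matrix.single 0 0 1

theorem trace_initialState : (initialState n).trace = 1 := by simp [initialState]

theorem trace_initialState_mul : (initialState n * (initialState n).conjTranspose).trace = 1 := by
  simp [initialState, Matrix.conjTranspose_single]

/-- The unitary layers indexed by natural numbers. -/
noncomputable def layerUnitary {Θ : Type*} (W : Fin (L + 1) → Θ → Matrix.unitaryGroup (Fin (2 ^ n)) ℂ)
    (k : ℕ) (θ : Θ) : Matrix.unitaryGroup (Fin (2 ^ n)) ℂ :=
  if h : k < L + 1 then W ⟨k, h⟩ θ else 1

theorem layerUnitary_of_lt {Θ : Type*} (W : Fin (L + 1) → Θ → Matrix.unitaryGroup (Fin (2 ^ n)) ℂ)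
    {k : ℕ} (hk : k < L + 1) : layerUnitary W k = W ⟨k, hk⟩ := by
  ext1 θ; simp [layerUnitary, hk]

theorem fourierCoeff_eq_trace {Θ : Type*}
    (W : Fin (L + 1) → Θ → Matrix.unitaryGroup (Fin (2 ^ n)) ℂ) (θ : Θ) (ω : ℝ) :
    M.fourierCoeff (fun l => W l θ) ω = (M.observable *
      ((layerUnitary W L θ : Matrix (Fin (2 ^ n)) (Fin (2 ^ n)) ℂ) *
      frequencyComponent M.eigenMatrix M.layerEigenvalue (initialState n)
        (fun i => layerUnitary W i θ) L ω *
      (layerUnitary W L θ : Matrix (Fin (2 ^ n)) (Fin (2 ^ n)) ℂ).conjTranspose)).trace := by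
  classical
  rw [frequencyComponent_eq_sum, fourierCoeff, ← Finset.univ_product_univ, Finset.sum_product]
  simp only [Finset.mul_sum, Finset.sum_mul, Matrix.trace_sum]
  refine Finset.sum_congr rfl fun J _ => Finset.sum_congr rfl fun J' _ => ?_
  have hpath : ∀ J : Fin L → Fin (2 ^ n), M.pathOperator (fun l => W l θ) J =
      (layerUnitary W L θ : Matrix (Fin (2 ^ n)) (Fin (2 ^ n)) ℂ) *
      (List.ofFn fun l : Fin L => ketBra (M.eigenMatrix l) (J l) (J l) *
        (layerUnitary W l θ : Matrix (Fin (2 ^ n)) (Fin (2 ^ n)) ℂ)).reverse.prod := by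
    intro J
    have h : ∀ l : Fin L, layerUnitary W l = W l.castSucc := fun l =>
      layerUnitary_of_lt W (l.2.trans (Nat.lt_succ_self L))
    simp only [pathOperator, eigenprojector_eq, h, layerUnitary_of_lt W (Nat.lt_succ_self L)]
    rfl
  -- The corner entry is a trace against `|0⟩⟨0|`, which is then moved cyclically between the two
  -- path operators.
  have hentry : ∀ A B : Matrix (Fin (2 ^ n)) (Fin (2 ^ n)) ℂ,
      (A * B) 0 0 = (B * initialState n * A).trace := by
    intro A B
    rw [Matrix.trace_mul_comm, ← Matrix.mul_assoc, initialState]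
    simp [Matrix.trace, Matrix.mul_apply, Matrix.single_apply, ite_and]
  simp only [layerEigenvalue_val, delta, sub_eq_zero, eq_comm (a := ω)]
  split_ifs with h
  · rw [Matrix.mul_assoc, hentry, hpath, hpath, Matrix.conjTranspose_mul]
    simp only [Matrix.mul_assoc, Complex.ofReal_one, one_smul]
  · simp

end ReuploadingModel

namespace ReuploadingModel

variable {n L : ℕ} (M : ReuploadingModel n L)

/-! ### Mean and variance of the Fourier coefficients -/

theorem trace_observable : M.observable.trace = M.traceO := by
  have h : star M.observable.trace = M.observable.trace := by
    rw [← Matrix.trace_conjTranspose, M.observable_isHermitian]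
  exact (Complex.conj_eq_iff_re.1 h).symm

theorem trace_observable_mul :
    (M.observable * M.observable.conjTranspose).trace = M.normSqO := by
  simp only [normSqO, Matrix.trace, Matrix.diag_apply, Matrix.mul_apply,
    Matrix.conjTranspose_apply, Complex.star_def, Complex.mul_conj']
  push_cast
  rfl

/-- Cauchy–Schwarz on the diagonal entries, which are then bounded by the full Hilbert–Schmidt norm.
Nonnegativity lets the profile inequalities pass to the variances. -/
theorem coeffTwo_nonneg (hn : 1 ≤ n) : 0 ≤ M.coeffTwo := by
  have hq := sub_pos.2 (one_lt_cast_sq (two_le_two_pow hn))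
  have hd : (2 : ℝ) ≤ M.dim := by rw [dim_eq]; exact_mod_cast two_le_two_pow hn
  rw [← M.dim_eq] at hq
  have h1 : M.traceO ^ 2 ≤ M.dim * ∑ a, (M.observable a a).re ^ 2 := by
    have h := sq_sum_le_card_mul_sum_sq (s := Finset.univ) (f := fun a => (M.observable a a).re)
    rw [Finset.card_univ, Fintype.card_fin, ← M.dim_eq] at h
    simpa [traceO, Matrix.trace] using h
  have h2 : ∑ a, (M.observable a a).re ^ 2 ≤ M.normSqO := by
    refine Finset.sum_le_sum fun a _ => ?_
    calc (M.observable a a).re ^ 2 ≤ ‖M.observable a a‖ ^ 2 :=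
          sq_le_sq.2 (by simpa using Complex.abs_re_le_norm _)
      _ ≤ ∑ b, ‖M.observable a b‖ ^ 2 :=
          Finset.single_le_sum (f := fun b => ‖M.observable a b‖ ^ 2)
            (fun _ _ => sq_nonneg _) (Finset.mem_univ a)
  have h3 : M.dim * ∑ a, (M.observable a a).re ^ 2 ≤ M.dim * M.normSqO := by gcongr
  unfold coeffTwo
  exact div_nonneg (by linarith) (by positivity)

/-- This is why the terms at `ω = 0` in the statement amount to removing the offset `δ/d` from the
layer recursion. -/
theorem coeffOne_sub (hn : 1 ≤ n) :
    M.coeffOne - (M.traceO / M.dim) ^ 2 = -(M.coeffTwo * (1 / M.dim)) := by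
  have hq := sub_pos.2 (one_lt_cast_sq (two_le_two_pow hn))
  have hd : (2 : ℝ) ≤ M.dim := by rw [dim_eq]; exact_mod_cast two_le_two_pow hn
  rw [← M.dim_eq] at hq
  unfold coeffOne coeffTwo
  field_simp
  ring

section Probability

variable {Θ : Type*} [MeasurableSpace Θ] {μ : Measure Θ} [IsProbabilityMeasure μ]
  {W : Fin (L + 1) → Θ → Matrix.unitaryGroup (Fin (2 ^ n)) ℂ}

theorem measurable_layerUnitary (hW : ∀ l, Measurable (W l)) (m : ℕ) :
    Measurable (layerUnitary W m) := by
  by_cases h : m < L + 1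
  · rw [layerUnitary_of_lt W h]
    exact hW _
  · have : layerUnitary W m = fun _ => 1 := by ext1 θ; simp [layerUnitary, h]
    rw [this]
    exact measurable_const

omit [IsProbabilityMeasure μ] in
-- The indices below `m` and the index `m` form disjoint blocks of the independent family.
theorem indepFun_layerUnitary (hW : ∀ l, Measurable (W l))
    (hindep : ProbabilityTheory.iIndepFun W μ) {m : ℕ} (hm : m < L + 1) :
    ProbabilityTheory.IndepFun (fun θ (i : Fin m) => layerUnitary W i θ) (layerUnitary W m) μ := by
  have h := hindep.indepFun_finset (Finset.univ.filter fun i : Fin (L + 1) => (i : ℕ) < m)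
    {⟨m, hm⟩} (by simp) hW
  have hψ : Measurable fun t : ({⟨m, hm⟩} : Finset (Fin (L + 1))) →
      Matrix.unitaryGroup (Fin (2 ^ n)) ℂ => t ⟨⟨m, hm⟩, by simp⟩ := measurable_pi_apply _
  have h' := h.comp
    (φ := fun t (i : Fin m) => t ⟨⟨i, i.2.trans hm⟩, by simp⟩)
    (measurable_pi_lambda _ fun i => measurable_pi_apply _) hψ
  convert h' using 1
  · ext1 θ
    ext1 i
    simp only [Function.comp, layerUnitary_of_lt W (i.2.trans hm)]
  · rw [layerUnitary_of_lt W hm]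
    rfl

theorem memLp_fourierCoeff (hW : ∀ l, Measurable (W l)) (ω : ℝ) :
    MemLp (fun θ => M.fourierCoeff (fun l => W l θ) ω) 2 μ := by
  simp only [fourierCoeff_eq_trace]
  exact memLp_overlap _ _ (measurable_layerUnitary hW) _ L ω 2

theorem integral_fourierCoeff (hn : 1 ≤ n) (hW : ∀ l, Measurable (W l))
    (hindep : ProbabilityTheory.iIndepFun W μ) (hdesign : ∀ l, IsTwoDesign μ (W l)) (ω : ℝ) :
    ∫ θ, M.fourierCoeff (fun l => W l θ) ω ∂μ = delta ω * M.traceO / M.dim := by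
  simp only [fourierCoeff_eq_trace]
  rw [integral_overlap _ _ M.eigenMatrix_mem (measurable_layerUnitary hW)
    (by rw [layerUnitary_of_lt W (Nat.lt_succ_self L)]; exact hdesign _) (two_le_two_pow hn)
    (indepFun_layerUnitary hW hindep (Nat.lt_succ_self L)), trace_initialState, trace_observable,
    dim_eq, mul_one]
  push_cast
  rfl

theorem complexVariance_fourierCoeff (hn : 1 ≤ n) (hW : ∀ l, Measurable (W l))
    (hindep : ProbabilityTheory.iIndepFun W μ) (hdesign : ∀ l, IsTwoDesign μ (W l)) (ω : ℝ) :
    complexVariance μ (fun θ => M.fourierCoeff (fun l => W l θ) ω) =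
      M.coeffTwo * varianceProfile M.layerEigenvalue L ω := by
  have hq := sub_pos.2 (one_lt_cast_sq (two_le_two_pow hn))
  have hd : (2 : ℝ) ≤ M.dim := by rw [dim_eq]; exact_mod_cast two_le_two_pow hn
  rw [← M.dim_eq] at hq
  have hdes : ∀ m < L + 1, IsTwoDesign μ (layerUnitary W m) := fun m hm => by
    rw [layerUnitary_of_lt W hm]; exact hdesign _
  have hind : ∀ m < L + 1, _ := fun m hm => indepFun_layerUnitary (m := m) hW hindep hm
  have hS := integral_trace_mul_conjTranspose M.layerEigenvalue (initialState n) M.eigenMatrix_mem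
    (measurable_layerUnitary hW) hdes (two_le_two_pow hn) hind trace_initialState
    trace_initialState_mul (Nat.le_succ L) ω
  have h2 := integral_overlap_mul_star M.layerEigenvalue (initialState n) M.eigenMatrix_mem
    (measurable_layerUnitary hW) (hdes L (Nat.lt_succ_self L)) (two_le_two_pow hn)
    (hind L (Nat.lt_succ_self L)) M.observable trace_initialState ω
  have h := complexVariance_eq (M.memLp_fourierCoeff (μ := μ) hW ω)
  rw [M.integral_fourierCoeff hn hW hindep hdesign ω] at h
  simp only [fourierCoeff_eq_trace] at h ⊢
  rw [h2, hS, trace_observable_mul, trace_observable] at h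
  rw [show ((2 ^ n : ℕ) : ℂ) = ((M.dim : ℝ) : ℂ) by rw [dim_eq]; push_cast; rfl] at h
  rw [← M.dim_eq] at h
  simp only [Complex.star_def, map_div₀, map_mul, Complex.conj_ofReal] at h
  apply Complex.ofReal_injective
  refine h.trans ?_
  norm_cast
  rw [coeffTwo]
  have hdel : delta ω * delta ω = delta ω := by
    by_cases h0 : ω = 0 <;> simp [delta, h0]
  have hsq : delta ω * M.traceO / M.dim * (delta ω * M.traceO / M.dim) =
      delta ω * M.traceO ^ 2 / M.dim ^ 2 := by
    rw [show delta ω * M.traceO / M.dim * (delta ω * M.traceO / M.dim) =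
      delta ω * delta ω * M.traceO ^ 2 / M.dim ^ 2 by ring, hdel]
  rw [hsq]
  field_simp
  ring

end Probability

end ReuploadingModel

/-! ### Assembly of the main theorem -/

theorem mainTheorem2 {n L : ℕ} (hn : 1 ≤ n) (hL : 1 ≤ L) (M : ReuploadingModel n L)
    {Θ : Type*} [MeasurableSpace Θ] (μ : MeasureTheory.Measure Θ)
    [MeasureTheory.IsProbabilityMeasure μ]
    (W : Fin (L + 1) → Θ → Matrix.unitaryGroup (Fin (2 ^ n)) ℂ)
    (hW : ∀ l, Measurable (W l))
    (hindep : ProbabilityTheory.iIndepFun W μ)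
    (hdesign : ∀ l, IsTwoDesign μ (W l)) :
    -- the Fourier decomposition of the model
    (∀ θ x, M.model (fun l => W l θ) x =
      ∑ ω ∈ M.spectrum, M.fourierCoeff (fun l => W l θ) ω *
        Complex.exp (Complex.I * (ω : ℂ) * (x : ℂ))) ∧
    -- the mean, and the variance through the exact recursion
    (∀ ω ∈ M.spectrum,
      MeasureTheory.MemLp (fun θ => M.fourierCoeff (fun l => W l θ) ω) 2 μ ∧
      ∫ θ, M.fourierCoeff (fun l => W l θ) ω ∂μ =
        M.observable.trace / (2 : ℂ) ^ n * (if ω = 0 then 1 else 0) ∧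
      complexVariance μ (fun θ => M.fourierCoeff (fun l => W l θ) ω) =
        (M.coeffOne - (M.traceO / M.dim) ^ 2) * ReuploadingModel.delta ω +
          M.coeffTwo * M.layerRecursion M.exactWeight (L - 1) ω) ∧
    -- the closed form solves the recursion with the approximate weights
    (∀ ω ∈ M.spectrum,
      M.approxVariance ω =
        (M.coeffOne - (M.traceO / M.dim) ^ 2) * ReuploadingModel.delta ω +
          M.coeffTwo * M.layerRecursion M.approxWeight (L - 1) ω) ∧
    -- the error of the approximation, frequency by frequency
    (∀ ω ∈ M.spectrum,
      complexVariance μ (fun θ => M.fourierCoeff (fun l => W l θ) ω) ≤ M.approxVariance ω ∧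
      M.approxVariance ω - complexVariance μ (fun θ => M.fourierCoeff (fun l => W l θ) ω) ≤
        ((L : ℝ) - 1) / M.dim * M.approxVariance ω +
          M.coeffTwo / M.dim * ((M.dim ^ 2 / (M.dim ^ 2 - 1)) ^ (L - 1) - 1)) ∧
    -- the error of the approximation, over the whole spectrum
    ∑ ω ∈ M.spectrum,
        |complexVariance μ (fun θ => M.fourierCoeff (fun l => W l θ) ω) - M.approxVariance ω| =
      M.dim / (M.dim - 1) * ((M.dim ^ 2 / (M.dim ^ 2 - 1)) ^ (L - 1) - 1) *
        ∑ ω ∈ M.spectrum,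
          complexVariance μ (fun θ => M.fourierCoeff (fun l => W l θ) ω) := by
  have hd2 := ReuploadingModel.two_le_two_pow hn
  have hd : (2 : ℝ) ≤ M.dim := by rw [M.dim_eq]; exact_mod_cast hd2
  have hC := M.coeffTwo_nonneg hn
  have hLr : ((L - 1 : ℕ) : ℝ) = (L : ℝ) - 1 := by push_cast [hL]; ring
  have hvar := M.complexVariance_fourierCoeff hn hW hindep hdesign
  have happrox := M.approxVariance_eq hn hL
  have hle : ∀ ω, ReuploadingModel.varianceProfile M.layerEigenvalue L ω ≤
      ReuploadingModel.approxProfile M.layerEigenvalue (L - 1) ω := fun ω => by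
    simpa [Nat.sub_add_cancel hL] using
      ReuploadingModel.varianceProfile_le_approxProfile M.layerEigenvalue hd2 (L - 1) ω
  refine ⟨fun θ x => M.model_eq_fourier _ x, fun ω _ => ⟨M.memLp_fourierCoeff hW ω, ?_, ?_⟩,
    fun ω _ => ?_, fun ω _ => ⟨?_, ?_⟩, ?_⟩
  · rw [M.integral_fourierCoeff hn hW hindep hdesign, M.trace_observable]
    by_cases h0 : ω = 0 <;> simp [ReuploadingModel.delta, ReuploadingModel.dim, h0]
  · rw [hvar, M.coeffOne_sub hn, M.layerRecursion_exactWeight hn (by omega),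
      Nat.sub_add_cancel hL]
    simp only [Pi.add_apply, Pi.smul_apply, smul_eq_mul]
    ring
  · rw [happrox, M.coeffOne_sub hn, M.layerRecursion_approxWeight hn (by omega)]
    simp only [Pi.add_apply, Pi.smul_apply, smul_eq_mul]
    ring
  · rw [hvar, happrox]
    exact mul_le_mul_of_nonneg_left (hle ω) hC
  · rw [hvar, happrox, ← mul_sub]
    have h := ReuploadingModel.approxProfile_sub_le M.layerEigenvalue hd2 (L - 1) ω
    rw [Nat.sub_add_cancel hL, ← M.dim_eq, hLr] at h
    refine (mul_le_mul_of_nonneg_left h hC).trans (le_of_eq ?_)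
    ring
  -- Both profiles vanish off the spectrum, so the finite sums over `Ω` equal the total masses over
  -- `ℝ`.
  · have hsupp : ∀ ω ∉ M.spectrum,
        ReuploadingModel.pathCount M.layerEigenvalue L ω = 0 := fun ω hω => by
      rwa [M.mem_spectrum, not_not] at hω
    have hV : ∑ ω ∈ M.spectrum, ReuploadingModel.varianceProfile M.layerEigenvalue L ω =
        1 - 1 / M.dim := by
      rw [M.dim_eq]
      exact (hasSum_sum_of_ne_finset_zero fun ω hω =>
        ReuploadingModel.varianceProfile_eq_zero M.layerEigenvalue hd2 L ω (hsupp ω hω)).unique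
        (ReuploadingModel.hasSum_varianceProfile M.layerEigenvalue hd2 L)
    have hA : ∑ ω ∈ M.spectrum, ReuploadingModel.approxProfile M.layerEigenvalue (L - 1) ω =
        (M.dim ^ 2 / (M.dim ^ 2 - 1)) ^ (L - 1) - 1 / M.dim := by
      rw [M.dim_eq]
      exact (hasSum_sum_of_ne_finset_zero fun ω hω =>
        ReuploadingModel.approxProfile_eq_zero M.layerEigenvalue hd2 (L - 1) ω
          (by rw [Nat.sub_add_cancel hL]; exact hsupp ω hω)).unique
        (ReuploadingModel.hasSum_approxProfile M.layerEigenvalue hd2 (L - 1))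
    have habs : ∀ ω, |complexVariance μ (fun θ => M.fourierCoeff (fun l => W l θ) ω) -
        M.approxVariance ω| = M.coeffTwo *
          (ReuploadingModel.approxProfile M.layerEigenvalue (L - 1) ω -
            ReuploadingModel.varianceProfile M.layerEigenvalue L ω) := fun ω => by
      rw [hvar, happrox, ← mul_sub, abs_mul, abs_of_nonneg hC, abs_sub_comm,
        abs_of_nonneg (sub_nonneg.2 (hle ω))]
    simp only [habs]
    simp only [hvar, ← Finset.mul_sum, Finset.sum_sub_distrib, hV, hA]
    -- The factor `d/(d-1)` is the inverse of the normalized variance mass `1 - 1/d`; it turns the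
    -- mass difference into a relative error.
    have h1 : M.dim / (M.dim - 1) * (1 - 1 / M.dim) = 1 := by
      have h0 : 0 < M.dim - 1 := by linarith
      field_simp
    linear_combination
      (-(M.coeffTwo * ((M.dim ^ 2 / (M.dim ^ 2 - 1)) ^ (L - 1) - 1))) * h1
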